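/- Let $\hbar>0$ and $r>0$. On $\mathscr H=L^2(\mathbb R,\mathbb C)$ let $Q$ be multiplication by the variable and $P=-i\hbar\,\frac{d}{dx}$, both on their maximal domains (weak derivative for $P$). Let $$a=\frac1{\sqrt2\,r}\Big(Q+i\frac{r^2}{\hbar}P\Big)$$ on $\mathrm{dom}\,Q\cap\mathrm{dom}\,P$, let $a^\dagger$ be its adjoint, and let $\mathscr D$ be the domain $\{\psi\in\mathrm{dom}\,a: a\psi\in\mathrm{dom}\,a^\dagger\}$ of the number operator $a^\dagger a$. For a self-adjoint operator $A$, $e^{itA}$ denotes the unitary group generated by $A$ in the sense of Stone's theorem. For $z\in\mathbb C$ define the displacement operator $$D(z)=W\big(-\sqrt2\,r\,\mathrm{Re}\,z,\ \sqrt2\,\hbar\,\mathrm{Im}\,z/r\big),\qquad W(q,p)=e^{ipq/2\hbar}\,e^{ipQ/\hbar}\,e^{iqP/\hbar}.$$ Let $f:\mathbb R^4\to\mathbb C$ and $\phi,\gamma:\mathbb R^4\to\mathbb R$ be continuously differentiable functions on space time, write $\partial_\mu=\partial/\partial x^\mu$ $(\mu=0,1,2,3)$, and put $$U(x)=e^{i\phi(x)}\,D(f(x))^\dagger\,e^{i\gamma(x)a^\dagger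 a}\,D(f(x)),\qquad \eta(x)=U(x)\zeta\quad(\zeta\in\mathscr H).$$ (a) If $\zeta\in\mathscr D$, then $x\mapsto\eta(x)$ is Fréchet-differentiable on $\mathbb R^4$. (b) Let $x\in\mathbb R^4$ and $\mu\in\{0,1,2,3\}$ be such that $\partial_\mu\gamma(x)\neq0$. Then the operator $$\begin{aligned}R_\mu(x)={}&-\hbar\,\partial_\mu\phi(x)-\hbar\,(\partial_\mu\gamma(x))\,(a+f(x))^\dagger(a+f(x))\\&+i\hbar\,(e^{i\gamma(x)}-1)\,(\partial_\mu f(x))\,(a+f(x))^\dagger-i\hbar\,(e^{-i\gamma(x)}-1)\,(\partial_\mu\overline{f(x)})\,(a+f(x)),\end{aligned}$$ where sums and products of unbounded operators carry their natural domains, has domain $\mathscr D$ and is self-adjoint. Moreover, for every $\zeta\in\mathscr D$ one has $\eta(x)\in\mathscr D$ and $$i\hbar\,\partial_\mu\eta(x)=R_\mu(x)\,\eta(x).$$ -/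

import Mathlib

open MeasureTheory Filter Topology
open scoped ContDiff ComplexConjugate LinearPMap

noncomputable section

namespace OscillatorField

/-! ### Unbounded operators and unitary groups -/

section Abstract

variable {E : Type*} [NormedAddCommGroup E] [InnerProductSpace ℂ E]

/-- The product `B A` of two unbounded operators on its natural domain
`{ψ ∈ dom A | A ψ ∈ dom B}`. -/
def opMul (B A : E →ₗ.[ℂ] E) : E →ₗ.[ℂ] E where
  domain := (B.domain.comap A.toFun).map A.domain.subtype
  toFun :=
    { toFun := fun ψ => B ⟨A ⟨ψ.1, by obtain ⟨y, -, hy⟩ := ψ.2; exact hy ▸ y.2⟩, by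
        obtain ⟨ψ, ⟨y, hy, rfl⟩⟩ := ψ; exact hy⟩
      map_add' := fun ψ χ => by
        rw [← LinearPMap.map_add]
        congr 1
        apply Subtype.ext
        exact LinearPMap.map_add A ⟨ψ.1, _⟩ ⟨χ.1, _⟩
      map_smul' := fun c ψ => by
        rw [RingHom.id_apply, ← LinearPMap.map_smul]
        congr 1
        apply Subtype.ext
        exact LinearPMap.map_smul A c ⟨ψ.1, _⟩ }

theorem mem_opMul_domain (B A : E →ₗ.[ℂ] E) (ψ : E) :
    ψ ∈ (opMul B A).domain ↔ ∃ h : ψ ∈ A.domain, A ⟨ψ, h⟩ ∈ B.domain := by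
  constructor
  · rintro ⟨y, hy, rfl⟩
    exact ⟨y.2, hy⟩
  · rintro ⟨h, hB⟩
    exact ⟨⟨ψ, h⟩, hB, rfl⟩

/-- The operator `A + c`, that is `A + c 𝟙`, with the domain of `A`. -/
def addConst (A : E →ₗ.[ℂ] E) (c : ℂ) : E →ₗ.[ℂ] E :=
  (c • (LinearMap.id : E →ₗ[ℂ] E)) +ᵥ A

/-- The everywhere defined operator `c 𝟙`. -/
def constOp (c : ℂ) : E →ₗ.[ℂ] E :=
  (c • (LinearMap.id : E →ₗ[ℂ] E)).toPMap ⊤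

variable [CompleteSpace E]

/-- `V` is the strongly continuous one-parameter group of unitary operators `V t = e^{itA}`
in the sense of Stone's theorem: `i A`, with exactly its domain, is the strong derivative of
`V` at `0`. -/
structure IsUnitaryGroupOf (A : E →ₗ.[ℂ] E) (V : ℝ → unitary (E →L[ℂ] E)) : Prop where
  add : ∀ s t, V (s + t) = V s * V t
  continuous : ∀ ψ : E, Continuous fun t => (V t : E →L[ℂ] E) ψ
  generator : ∀ ψ χ : E, (ψ, χ) ∈ A.graph ↔
    Tendsto (fun t : ℝ => (t : ℂ)⁻¹ • ((V t : E →L[ℂ] E) ψ - ψ)) (𝓝[≠] 0) (𝓝 (Complex.I • χ))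

open Classical in
/-- The unitary operator `e^{itA}` of a self-adjoint operator `A`: the value at `t` of the
one-parameter group that Stone's theorem attaches to `A` (and `1` if `A` generates no such
group). -/
def unitaryExp (A : E →ₗ.[ℂ] E) (t : ℝ) : unitary (E →L[ℂ] E) :=
  if h : ∃ V : ℝ → unitary (E →L[ℂ] E), IsUnitaryGroupOf A V then h.choose t else 1

theorem IsUnitaryGroupOf.zero {A : E →ₗ.[ℂ] E} {V : ℝ → unitary (E →L[ℂ] E)}
    (h : IsUnitaryGroupOf A V) : V 0 = 1 := by
  have := h.add 0 0
  rw [add_zero] at this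
  exact (mul_eq_left (a := V 0) (b := V 0)).1 this.symm

theorem IsUnitaryGroupOf.hasDerivAt {A : E →ₗ.[ℂ] E} {V : ℝ → unitary (E →L[ℂ] E)}
    (h : IsUnitaryGroupOf A V) (ψ : A.domain) (t : ℝ) :
    HasDerivAt (fun s => (V s : E →L[ℂ] E) ψ) ((V t : E →L[ℂ] E) (Complex.I • A ψ)) t := by
  rw [hasDerivAt_iff_tendsto_slope_zero]
  have h0 := (h.generator ψ (A ψ)).1 (A.mem_graph ψ)
  have h1 := ((V t : E →L[ℂ] E).continuous.tendsto _).comp h0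
  refine h1.congr fun s => ?_
  simp only [Function.comp_apply, map_smul, map_sub, h.add t s]
  rw [← Complex.ofReal_inv, Complex.coe_smul]
  rfl

theorem IsUnitaryGroupOf.mem_graph {A : E →ₗ.[ℂ] E} {V : ℝ → unitary (E →L[ℂ] E)}
    (h : IsUnitaryGroupOf A V) (ψ : A.domain) (t : ℝ) :
    ((V t : E →L[ℂ] E) ψ, (V t : E →L[ℂ] E) (A ψ)) ∈ A.graph := by
  rw [h.generator]
  have h0 := (h.generator ψ (A ψ)).1 (A.mem_graph ψ)
  have h1 := ((V t : E →L[ℂ] E).continuous.tendsto _).comp h0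
  rw [map_smul] at h1
  refine h1.congr fun s => ?_
  have hc : (V s : E →L[ℂ] E) ((V t : E →L[ℂ] E) ψ) = (V t : E →L[ℂ] E) ((V s : E →L[ℂ] E) ψ) := by
    have := congrArg (fun W : unitary (E →L[ℂ] E) => (W : E →L[ℂ] E) (ψ : E))
      ((h.add s t).symm.trans ((congrArg V (add_comm s t)).trans (h.add t s)))
    exact this
  simp only [Function.comp_apply, map_smul, map_sub, hc]

theorem norm_unitary_apply (W : unitary (E →L[ℂ] E)) (ψ : E) : ‖(W : E →L[ℂ] E) ψ‖ = ‖ψ‖ :=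
  ((W : E →L[ℂ] E).norm_map_iff_adjoint_comp_self.2 (by
    exact Unitary.coe_star_mul_self W)) ψ

/-- The group in Stone's theorem is determined by its generator. -/
theorem IsUnitaryGroupOf.unique {A : E →ₗ.[ℂ] E} (hA : Dense (A.domain : Set E))
    {V W : ℝ → unitary (E →L[ℂ] E)} (hV : IsUnitaryGroupOf A V) (hW : IsUnitaryGroupOf A W) :
    V = W := by
  let _ : InnerProductSpace ℝ E := InnerProductSpace.rclikeToReal ℂ E
  have sym : ∀ u : A.domain, RCLike.re (inner ℂ (u : E) (Complex.I • A u)) = 0 := by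
    intro u
    have hd := HasDerivAt.norm_sq (F := E) (hV.hasDerivAt u 0)
    have hc : HasDerivAt (fun s => ‖(V s : E →L[ℂ] E) (u : E)‖ ^ 2) 0 0 := by
      simp only [norm_unitary_apply]
      exact hasDerivAt_const _ _
    have := hd.unique hc
    rw [hV.zero] at this
    have h2 : inner ℝ (u : E) (Complex.I • A u) = 0 := by
      simpa using this
    rw [real_inner_eq_re_inner ℂ] at h2
    exact h2
  funext t
  apply Subtype.ext
  apply ContinuousLinearMap.coeFn_injective
  refine Continuous.ext_on hA (V t : E →L[ℂ] E).continuous (W t : E →L[ℂ] E).continuous ?_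
  intro ψ hψ
  have key : ∀ s, HasDerivAt
      (fun s => ‖(V s : E →L[ℂ] E) ψ - (W s : E →L[ℂ] E) ψ‖ ^ 2) 0 s := by
    intro s
    have hd := HasDerivAt.norm_sq (F := E)
      ((hV.hasDerivAt ⟨ψ, hψ⟩ s).sub (hW.hasDerivAt ⟨ψ, hψ⟩ s))
    have hg := A.graph.sub_mem (hV.mem_graph ⟨ψ, hψ⟩ s) (hW.mem_graph ⟨ψ, hψ⟩ s)
    obtain ⟨u, hu1, hu2⟩ := A.mem_graph_iff.1 hg
    have h0 := sym u
    simp only [Prod.fst_sub, Prod.snd_sub] at hu1 hu2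
    rw [hu2, hu1, smul_sub, ← map_smul, ← map_smul] at h0
    convert! hd using 1
    rw [real_inner_eq_re_inner ℂ]
    simp only [Pi.sub_apply]
    rw [h0, mul_zero]
  have hconst := is_const_of_deriv_eq_zero (fun s => (key s).differentiableAt)
    (fun s => (key s).deriv) t 0
  rw [hV.zero, hW.zero] at hconst
  simpa [sub_eq_zero] using hconst

theorem unitaryExp_eq {A : E →ₗ.[ℂ] E} (hA : Dense (A.domain : Set E))
    {V : ℝ → unitary (E →L[ℂ] E)} (hV : IsUnitaryGroupOf A V) (t : ℝ) :
    unitaryExp A t = V t := by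
  have h : ∃ V : ℝ → unitary (E →L[ℂ] E), IsUnitaryGroupOf A V := ⟨V, hV⟩
  rw [unitaryExp, dif_pos h, h.choose_spec.unique hA hV]

end Abstract

/-! ### The quantum harmonic oscillator -/

/-- The Hilbert space `L²(ℝ, ℂ)`. -/
abbrev OscSpace : Type := Lp ℂ 2 (volume : Measure ℝ)

/-- The position operator `(Q ψ)(x) = x ψ(x)`, on its maximal domain. -/
def positionOp : OscSpace →ₗ.[ℂ] OscSpace where
  domain :=
    { carrier := {ψ | MemLp (fun x : ℝ => (x : ℂ) * ψ x) 2 volume}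
      zero_mem' := by
        refine (MemLp.zero' (p := 2) (μ := (volume : Measure ℝ)) (ε := ℂ)).ae_eq ?_
        filter_upwards [Lp.coeFn_zero ℂ 2 (volume : Measure ℝ)] with x hx
        rw [hx, Pi.zero_apply, mul_zero]
      add_mem' := fun {ψ χ} hψ hχ => by
        refine (MemLp.add hψ hχ).ae_eq ?_
        filter_upwards [Lp.coeFn_add ψ χ] with x hx
        rw [hx, Pi.add_apply, Pi.add_apply, mul_add]
      smul_mem' := fun c ψ hψ => by
        refine (MemLp.const_smul hψ c).ae_eq ?_
        filter_upwards [Lp.coeFn_smul c ψ] with x hx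
        simp only [Pi.smul_apply, smul_eq_mul, hx]
        ring }
  toFun :=
    { toFun := fun ψ => MemLp.toLp _ ψ.2
      map_add' := fun ψ χ => by
        apply Lp.ext
        filter_upwards [Lp.coeFn_add (ψ : OscSpace) (χ : OscSpace), MemLp.coeFn_toLp ψ.2,
          MemLp.coeFn_toLp χ.2, MemLp.coeFn_toLp (ψ + χ).2,
          Lp.coeFn_add (MemLp.toLp _ ψ.2) (MemLp.toLp _ χ.2)] with x h1 h2 h3 h4 h5
        rw [h4, h5, Pi.add_apply, h2, h3, Submodule.coe_add, h1, Pi.add_apply, mul_add]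
      map_smul' := fun c ψ => by
        apply Lp.ext
        filter_upwards [Lp.coeFn_smul c (ψ : OscSpace), MemLp.coeFn_toLp ψ.2,
          MemLp.coeFn_toLp (c • ψ).2, Lp.coeFn_smul c (MemLp.toLp _ ψ.2)] with x h1 h2 h3 h4
        rw [h3, RingHom.id_apply, h4, Pi.smul_apply, h2, Submodule.coe_smul, h1, Pi.smul_apply,
          smul_eq_mul, smul_eq_mul]
        ring }

theorem integrable_testFunction_smul (ψ : OscSpace) {g : ℝ → ℝ} (hg : Continuous g)
    (hs : HasCompactSupport g) : Integrable fun x => g x • ψ x :=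
  ((Lp.memLp ψ).locallyIntegrable (by norm_num)).integrable_smul_left_of_hasCompactSupport hg hs

/-- The pairs `(ψ, χ)` in `L² × L²` such that `χ` is the weak derivative of `ψ`. -/
def weakDerivGraph : Submodule ℂ (OscSpace × OscSpace) where
  carrier := {p | ∀ g : ℝ → ℝ, ContDiff ℝ ∞ g → HasCompactSupport g →
    ∫ x, deriv g x • p.1 x = - ∫ x, g x • p.2 x}
  zero_mem' := fun g _ _ => by
    have h0 : ∀ k : ℝ → ℝ, ∫ x, k x • (0 : OscSpace) x = 0 := fun k => by
      rw [← integral_zero ℝ ℂ]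
      apply integral_congr_ae
      filter_upwards [Lp.coeFn_zero ℂ 2 (volume : Measure ℝ)] with x hx
      rw [hx, Pi.zero_apply, smul_zero]
    simp only [Prod.fst_zero, Prod.snd_zero, h0, neg_zero]
  add_mem' := fun {p q} hp hq g hg hs => by
    have h : ∀ (k : ℝ → ℝ) (_ : Continuous k) (_ : HasCompactSupport k) (ψ χ : OscSpace),
        ∫ x, k x • (ψ + χ) x = (∫ x, k x • ψ x) + ∫ x, k x • χ x := fun k hk hks ψ χ => by
      rw [← integral_add (integrable_testFunction_smul ψ hk hks)
        (integrable_testFunction_smul χ hk hks)]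
      apply integral_congr_ae
      filter_upwards [Lp.coeFn_add ψ χ] with x hx
      rw [hx, Pi.add_apply, smul_add]
    have hg' : Continuous (deriv g) := hg.continuous_deriv (by simp)
    rw [Prod.fst_add, Prod.snd_add, h _ hg' hs.deriv, h _ hg.continuous hs, hp g hg hs,
      hq g hg hs, neg_add]
  smul_mem' := fun c p hp g hg hs => by
    have h : ∀ (k : ℝ → ℝ) (ψ : OscSpace),
        ∫ x, k x • (c • ψ) x = c * ∫ x, k x • ψ x := fun k ψ => by
      rw [← integral_const_mul]
      apply integral_congr_ae
      filter_upwards [Lp.coeFn_smul c ψ] with x hx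
      simp only [hx, Pi.smul_apply, smul_eq_mul, Complex.real_smul]
      ring
    rw [Prod.smul_fst, Prod.smul_snd, h, h, hp g hg hs, mul_neg]

/-- The derivative `d/dx` on its maximal domain `{ψ ∈ L² | ψ' ∈ L²}`, `ψ'` the weak derivative. -/
def weakDeriv : OscSpace →ₗ.[ℂ] OscSpace := weakDerivGraph.toLinearPMap

theorem weakDeriv_graph : weakDeriv.graph = weakDerivGraph := by
  apply Submodule.toLinearPMap_graph_eq
  rintro ⟨ψ, χ⟩ h h0
  change ψ = 0 at h0
  subst h0
  have hz := weakDerivGraph.zero_mem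
  have hae : ∀ᵐ x, χ x = 0 := by
    refine ae_eq_zero_of_integral_contDiff_smul_eq_zero
      ((Lp.memLp χ).locallyIntegrable (by norm_num)) fun g hg hs => ?_
    have h1 := h g hg hs
    have h2 : ∫ x, deriv g x • (0 : OscSpace) x = 0 := by
      rw [← integral_zero ℝ ℂ]
      apply integral_congr_ae
      filter_upwards [Lp.coeFn_zero ℂ 2 (volume : Measure ℝ)] with x hx
      rw [hx, Pi.zero_apply, smul_zero]
    simpa [h2] using h1.symm
  exact (Lp.eq_zero_iff_ae_eq_zero).2 hae

/-- The momentum operator `P = -iħ d/dx`. -/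
def momentumOp (ħ : ℝ) : OscSpace →ₗ.[ℂ] OscSpace := (-(Complex.I * ħ)) • weakDeriv

/-- The annihilation operator `a = (Q + i (r² / ħ) P) / (√2 r)`, a closed operator on
`dom Q ∩ dom P`. -/
def annihilationOp (ħ r : ℝ) : OscSpace →ₗ.[ℂ] OscSpace :=
  (((√2 * r : ℝ) : ℂ)⁻¹) • (positionOp + (Complex.I * ((r ^ 2 / ħ : ℝ) : ℂ)) • momentumOp ħ)

/-- The operator `a + z`. -/
def shiftedAnnihilationOp (ħ r : ℝ) (z : ℂ) : OscSpace →ₗ.[ℂ] OscSpace :=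
  addConst (annihilationOp ħ r) z

/-- The number operator `a† a`. -/
def numberOp (ħ r : ℝ) : OscSpace →ₗ.[ℂ] OscSpace :=
  opMul (annihilationOp ħ r)† (annihilationOp ħ r)

/-- The Weyl operator `W(q, p) = e^{ipq/2ħ} e^{ipQ/ħ} e^{iqP/ħ}`. -/
def weylOp (ħ q p : ℝ) : OscSpace →L[ℂ] OscSpace :=
  Complex.exp (Complex.I * (p * q / (2 * ħ) : ℝ)) •
    ((unitaryExp positionOp (p / ħ) : OscSpace →L[ℂ] OscSpace) *
      (unitaryExp (momentumOp ħ) (q / ħ) : OscSpace →L[ℂ] OscSpace))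

/-- The displacement operator `D(z) = exp(z a† - z̄ a) = W(-√2 r Re z, √2 ħ Im z / r)`. -/
def displacementOp (ħ r : ℝ) (z : ℂ) : OscSpace →L[ℂ] OscSpace :=
  weylOp ħ (-(√2 * r * z.re)) (√2 * ħ * z.im / r)

/-! ### Fields over Minkowski space -/

/-- Space time, with coordinates `x 0, x 1, x 2, x 3`. -/
abbrev Minkowski : Type := Fin 4 → ℝ

/-- The partial derivative `∂_μ g (x) = ∂g/∂x^μ (x)`. -/
def partialDeriv {F : Type*} [NormedAddCommGroup F] [NormedSpace ℝ F] (μ : Fin 4)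
    (g : Minkowski → F) (x : Minkowski) : F :=
  fderiv ℝ g x (Pi.single μ 1)

/-- `U(x) = e^{iφ(x)} D(f(x))† e^{iγ(x) a†a} D(f(x))`. -/
def gaugeOp (ħ r : ℝ) (f : Minkowski → ℂ) (φ γ : Minkowski → ℝ) (x : Minkowski) :
    OscSpace →L[ℂ] OscSpace :=
  Complex.exp (Complex.I * φ x) •
    (star (displacementOp ħ r (f x)) *
      (unitaryExp (numberOp ħ r) (γ x) : OscSpace →L[ℂ] OscSpace) *
      displacementOp ħ r (f x))

/-- The operator
`R_μ(x) = -ħ ∂_μφ - ħ (∂_μγ) (a+f)†(a+f) + iħ (e^{iγ} - 1) (∂_μf) (a+f)†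
  - iħ (e^{-iγ} - 1) (∂_μ f̄) (a+f)`,
all functions taken at `x`; sums and products of unbounded operators have their natural
domains. -/
def potentialOp (ħ r : ℝ) (f : Minkowski → ℂ) (φ γ : Minkowski → ℝ) (μ : Fin 4)
    (x : Minkowski) : OscSpace →ₗ.[ℂ] OscSpace :=
  constOp ((-(ħ * partialDeriv μ φ x) : ℝ) : ℂ)
    - ((ħ * partialDeriv μ γ x : ℝ) : ℂ) •
        opMul (shiftedAnnihilationOp ħ r (f x))† (shiftedAnnihilationOp ħ r (f x))
    + (Complex.I * ħ * (Complex.exp (Complex.I * γ x) - 1) * partialDeriv μ f x) •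
        (shiftedAnnihilationOp ħ r (f x))†
    - (Complex.I * ħ * (Complex.exp (-(Complex.I * γ x)) - 1) *
          partialDeriv μ (fun y => conj (f y)) x) •
        shiftedAnnihilationOp ħ r (f x)

end OscillatorField

end

open OscillatorField

namespace OscillatorField

noncomputable section

set_option linter.unusedSectionVars false

/-! ### Unitary groups, diagonal operators and ladder operators in an abstract Hilbert space. -/

section Abstract

variable {E : Type*} [NormedAddCommGroup E] [InnerProductSpace ℂ E] [CompleteSpace E]

local notation "⟪" x ", " y "⟫" => inner ℂ x y

/-! ### Unitary groups -/

/-! Everything rests on two covariance rules: `D(z)† a D(z) = a + z`, and `e^{-iθN} a e^{iθN} =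
e^{iθ} a` for `N = a†a`. By them `D(z)` and `e^{iθN}` preserve the domain of `N`, and the images of
a vector under `a`, `a†`, `N` can be tracked explicitly (`LadderImages.displace`,
`LadderImages.rotate`).

Derivative of `η`. On the domain of `N`, `z ↦ D(z)ψ` is differentiable with derivative `D(z)(δ a† -
δ̄ a + i Im(z̄δ))ψ` in the direction `δ`, and `θ ↦ e^{iθN}ψ` has derivative `e^{iθN} iNψ`. The
factors of `U(x)` are only strongly differentiable, but they are isometries, so the product rule
`hasFDerivAt_isometry_apply` applies. Both sides of the field equation then become combinations of
the images of `ζ`, `aζ`, `a†ζ`, `Nζ` under `e^{iφ} D(f)† e^{iγN} D(f)`, and four scalar identities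
remain (`gaugeOp_equation`).

Self-adjointness. With `g = ∂_μγ ≠ 0`, `κ = -i(e^{iγ} - 1)∂_μf / g` and `w = f + κ`, completing the
square gives `R_μ = -ħg (a + w)†(a + w) + ħg|κ|² - ħ∂_μφ`. So `D(w)` conjugates `R_μ` to a real
affine function of `N`, which is diagonal with real eigenvalues (`isSelfAdjoint_potentialOp`).

The analytic core is `isLowering_annihilationOp`: on exactly `dom Q ∩ dom P`, `a` is the maximal
lowering operator of the Hermite basis. It uses completeness of the Hermite functions and closedness
of `Q` and `P`. The exponentials defined through Stone's theorem become concrete by uniqueness of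
the group: `e^{itQ}` is multiplication by `e^{itx}`, `e^{itP}` is translation by `ħt`, and `e^{iθN}`
multiplies the `n`-th Hermite coefficient by `e^{inθ}`. -/

/-- The unitary operators given by a one-parameter group of linear isometries. -/
def unitaryGroup (U : ℝ → E →ₗᵢ[ℂ] E) (h0 : ∀ ψ, U 0 ψ = ψ)
    (hadd : ∀ s t ψ, U (s + t) ψ = U s (U t ψ)) (t : ℝ) : unitary (E →L[ℂ] E) :=
  Unitary.linearIsometryEquiv.symm
    { toLinearEquiv := LinearEquiv.ofLinearMap (U t).toLinearMap (U (-t)).toLinearMap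
        (by ext ψ; simp [← hadd, h0]) (by ext ψ; simp [← hadd, h0])
      norm_map' := fun ψ => (U t).norm_map ψ }

theorem unitaryGroup_add (U : ℝ → E →ₗᵢ[ℂ] E) (h0 : ∀ ψ, U 0 ψ = ψ)
    (hadd : ∀ s t ψ, U (s + t) ψ = U s (U t ψ)) (s t : ℝ) :
    unitaryGroup U h0 hadd (s + t) = unitaryGroup U h0 hadd s * unitaryGroup U h0 hadd t := by
  apply Subtype.ext
  ext ψ
  exact hadd s t ψ

theorem inner_unitary_apply (W : unitary (E →L[ℂ] E)) (ψ χ : E) :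
    ⟪(W : E →L[ℂ] E) ψ, (W : E →L[ℂ] E) χ⟫ = ⟪ψ, χ⟫ :=
  (Unitary.linearIsometryEquiv W).inner_map_map ψ χ

/-- The function `s ↦ ⟪V s ψ, V s ξ⟫` is constant; its derivative at `0` gives the symmetry of the
generator. -/
theorem IsUnitaryGroupOf.inner_symm {A : E →ₗ.[ℂ] E} {V : ℝ → unitary (E →L[ℂ] E)}
    (h : IsUnitaryGroupOf A V) {ψ χ ξ τ : E} (h1 : (ψ, χ) ∈ A.graph) (h2 : (ξ, τ) ∈ A.graph) :
    ⟪χ, ξ⟫ = ⟪ψ, τ⟫ := by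
  obtain ⟨u, rfl, rfl⟩ := A.mem_graph_iff.1 h1
  obtain ⟨v, rfl, rfl⟩ := A.mem_graph_iff.1 h2
  have hd := (h.hasDerivAt u 0).inner ℂ (h.hasDerivAt v 0)
  simp only [inner_unitary_apply] at hd
  have := hd.unique (hasDerivAt_const _ _)
  simp only [inner_smul_left, inner_smul_right, Complex.conj_I] at this
  have h3 : Complex.I * (⟪(u : E), A v⟫ - ⟪A u, (v : E)⟫) = 0 := by linear_combination this
  rcases mul_eq_zero.1 h3 with h4 | h4
  · exact absurd h4 Complex.I_ne_zero
  · exact (sub_eq_zero.1 h4).symm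

/-- The product rule for a strongly differentiable family of isometries. -/
theorem hasFDerivAt_isometry_apply {X : Type*} [NormedAddCommGroup X] [NormedSpace ℝ X]
    [FiniteDimensional ℝ X] {V : X → E →L[ℂ] E} {ξ : X → E} {x : X} {ξ' L : X →L[ℝ] E}
    (hV : ∀ y ψ, ‖V y ψ‖ = ‖ψ‖) (hc : ∀ ψ, ContinuousAt (fun y => V y ψ) x)
    (hξ : HasFDerivAt ξ ξ' x) (hL : HasFDerivAt (fun y => V y (ξ x)) L x) :
    HasFDerivAt (fun y => V y (ξ y)) (L + ((V x).restrictScalars ℝ).comp ξ') x := by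
  rw [hasFDerivAt_iff_isLittleO] at *
  -- The increment splits into three small terms: `V y` on the remainder of `ξ`, which keeps its
  -- norm; `(V y - V x) ξ'(y - x)`; and the remainder of `V` at the frozen vector `ξ x`.
  have h1 : (fun y => V y (ξ y - ξ x - ξ' (y - x))) =o[𝓝 x] fun y => y - x := by
    refine (Asymptotics.isLittleO_norm_left).1 ?_
    simp only [hV]
    exact (Asymptotics.isLittleO_norm_left).2 hξ
  -- Strong continuity suffices: after composition with `ξ'`, whose source is finite dimensional,
  -- pointwise continuity is norm continuity.
  have hcont : Tendsto (fun y => ((V y).restrictScalars ℝ).comp ξ') (𝓝 x)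
      (𝓝 (((V x).restrictScalars ℝ).comp ξ')) := by
    have : ContinuousAt (fun y => ((V y).restrictScalars ℝ).comp ξ') x := by
      rw [continuousAt_clm_apply]
      intro v
      exact hc (ξ' v)
    exact this
  have h2 : (fun y => (((V y).restrictScalars ℝ).comp ξ' - ((V x).restrictScalars ℝ).comp ξ')
      (y - x)) =o[𝓝 x] fun y => y - x := by
    have h0 : (fun y => ((V y).restrictScalars ℝ).comp ξ' - ((V x).restrictScalars ℝ).comp ξ')
        =o[𝓝 x] fun _ => (1 : ℝ) := by
      rw [Asymptotics.isLittleO_one_iff]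
      simpa using hcont.sub_const (((V x).restrictScalars ℝ).comp ξ')
    refine Asymptotics.IsBigO.trans_isLittleO (g := fun y =>
      ‖((V y).restrictScalars ℝ).comp ξ' - ((V x).restrictScalars ℝ).comp ξ'‖ * ‖y - x‖) ?_ ?_
    · refine Asymptotics.isBigO_of_le _ fun y => ?_
      rw [norm_mul, norm_norm, norm_norm]
      exact ContinuousLinearMap.le_opNorm _ _
    · simpa using h0.norm_left.mul_isBigO
        ((Asymptotics.isBigO_refl (fun y => y - x) (𝓝 x)).norm_left.norm_right)
  refine ((h1.add h2).add hL).congr_left fun y => ?_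
  simp only [map_sub, sub_apply, add_apply,
    ContinuousLinearMap.comp_apply, ContinuousLinearMap.coe_restrictScalars']
  abel

/-! ### Expansions in a Hilbert basis -/

variable (b : HilbertBasis ℕ ℂ E)

theorem hilbertBasis_ext {ψ χ : E} (h : ∀ n, ⟪b n, ψ⟫ = ⟪b n, χ⟫) : ψ = χ := by
  apply b.repr.injective
  ext n
  simpa [b.repr_apply_apply] using h n

theorem hasSum_sq_norm_inner (ψ : E) : HasSum (fun n => ‖⟪b n, ψ⟫‖ ^ 2) (‖ψ‖ ^ 2) := by
  have h := b.hasSum_inner_mul_inner ψ ψ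
  have h2 := Complex.hasSum_re h
  rw [inner_self_eq_norm_sq_to_K] at h2
  convert! h2 using 1
  · funext n
    rw [← inner_conj_symm ψ (b n), mul_comm, Complex.mul_conj, Complex.ofReal_re,
      Complex.normSq_eq_norm_sq]
  · norm_cast

theorem exists_inner_eq {c : ℕ → ℂ} (hc : Summable fun n => ‖c n‖ ^ 2) :
    ∃ ψ : E, ∀ n, ⟪b n, ψ⟫ = c n := by
  have hm : Memℓp c 2 := memℓp_gen (by simpa using hc)
  refine ⟨b.repr.symm ⟨c, hm⟩, fun n => ?_⟩
  rw [← b.repr_apply_apply, LinearIsometryEquiv.apply_symm_apply]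

theorem exists_inner_eq_of_norm_le {c : ℕ → ℂ} (χ : E) (hc : ∀ n, ‖c n‖ ≤ ‖⟪b n, χ⟫‖) :
    ∃ ψ : E, ∀ n, ⟪b n, ψ⟫ = c n :=
  exists_inner_eq b (Summable.of_nonneg_of_le (fun _ => by positivity)
    (fun n => pow_le_pow_left₀ (norm_nonneg _) (hc n) 2) (hasSum_sq_norm_inner b χ).summable)

/-- Dominated convergence for the coefficients in a Hilbert basis. -/
theorem tendsto_of_dominated_inner {ι : Type*} {l : Filter ι} {ψ : ι → E} {χ : E} (ξ : E)
    (hb : ∀ᶠ i in l, ∀ n, ‖⟪b n, ψ i⟫ - ⟪b n, χ⟫‖ ≤ ‖⟪b n, ξ⟫‖)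
    (hp : ∀ n, Tendsto (fun i => ⟪b n, ψ i⟫) l (𝓝 ⟪b n, χ⟫)) : Tendsto ψ l (𝓝 χ) := by
  rw [tendsto_iff_norm_sub_tendsto_zero]
  have h : Tendsto (fun i => ‖ψ i - χ‖ ^ 2) l (𝓝 0) := by
    have := tendsto_tsum_of_dominated_convergence (𝓕 := l)
      (f := fun i n => ‖⟪b n, ψ i - χ⟫‖ ^ 2) (g := fun _ => 0)
      (hasSum_sq_norm_inner b ξ).summable (fun n => by
        have := ((hp n).sub_const ⟪b n, χ⟫).norm.pow 2
        simpa [inner_sub_right] using this) (by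
        filter_upwards [hb] with i hi n
        rw [Real.norm_of_nonneg (by positivity), inner_sub_right]
        exact pow_le_pow_left₀ (norm_nonneg _) (hi n) 2)
    simp only [tsum_zero] at this
    refine this.congr fun i => ?_
    exact (hasSum_sq_norm_inner b (ψ i - χ)).tsum_eq
  have h2 := h.sqrt
  simpa using h2

theorem dense_of_hilbertBasis_mem {S : Submodule ℂ E} (h : ∀ n, b n ∈ S) : Dense (S : Set E) := by
  have h1 := b.dense_span
  have h2 : (Submodule.span ℂ (Set.range b)) ≤ S := by
    rw [Submodule.span_le]
    rintro _ ⟨n, rfl⟩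
    exact h n
  rw [Submodule.dense_iff_topologicalClosure_eq_top, eq_top_iff, ← h1]
  exact Submodule.topologicalClosure_mono h2

theorem mem_adjoint_graph_iff {A : E →ₗ.[ℂ] E} (hA : Dense (A.domain : Set E)) {ψ χ : E} :
    (ψ, χ) ∈ A†.graph ↔ ∀ ξ τ, (ξ, τ) ∈ A.graph → ⟪χ, ξ⟫ = ⟪ψ, τ⟫ := by
  constructor
  · intro h ξ τ h2
    obtain ⟨u, rfl, rfl⟩ := (A†).mem_graph_iff.1 h
    obtain ⟨v, rfl, rfl⟩ := A.mem_graph_iff.1 h2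
    exact LinearPMap.adjoint_isFormalAdjoint hA u v
  · intro h
    have hx : ∀ x : A.domain, ⟪χ, (x : E)⟫ = ⟪ψ, A x⟫ := fun x => h _ _ (A.mem_graph x)
    have hm : ψ ∈ A†.domain := LinearPMap.mem_adjoint_domain_of_exists ψ ⟨χ, hx⟩
    rw [LinearPMap.mem_graph_iff]
    exact ⟨⟨ψ, hm⟩, rfl, LinearPMap.adjoint_apply_eq hA ⟨ψ, hm⟩ hx⟩

/-- The graph is maximal: testing an adjoint pair against the eigenvectors `b n` already yields the
coefficient relation. The converse is Parseval together with the reality of the eigenvalues. -/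
theorem isSelfAdjoint_of_diagonal {A : E →ₗ.[ℂ] E} (lam : ℕ → ℝ)
    (h : ∀ ψ χ, (ψ, χ) ∈ A.graph ↔ ∀ n, ⟪b n, χ⟫ = lam n * ⟪b n, ψ⟫) : IsSelfAdjoint A := by
  have hb : ∀ k, (b k, (lam k : ℂ) • b k) ∈ A.graph := fun k => by
    rw [h]
    intro n
    rw [inner_smul_right, orthonormal_iff_ite.1 b.orthonormal n k]
    split_ifs with hn
    · rw [hn]
    · simp
  have hd : Dense (A.domain : Set E) :=
    dense_of_hilbertBasis_mem b fun k => LinearPMap.mem_domain_of_mem_graph (hb k)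
  rw [LinearPMap.isSelfAdjoint_def]
  apply LinearPMap.eq_of_eq_graph
  ext ⟨ψ, χ⟩
  rw [mem_adjoint_graph_iff hd, h]
  constructor
  · intro H n
    have := congrArg conj (H _ _ (hb n))
    rw [inner_conj_symm, inner_conj_symm, inner_smul_left] at this
    simpa using this
  · intro H ξ τ hξ
    rw [h] at hξ
    rw [← b.tsum_inner_mul_inner, ← b.tsum_inner_mul_inner]
    congr 1
    funext n
    rw [hξ n, ← inner_conj_symm χ, H n, map_mul, Complex.conj_ofReal, inner_conj_symm]
    ring

/-! ### The unitary group of a diagonal operator -/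

theorem exists_inner_eq_mul {c : ℕ → ℂ} (hc : ∀ n, ‖c n‖ ≤ 1) (ψ : E) :
    ∃ χ : E, ∀ n, ⟪b n, χ⟫ = c n * ⟪b n, ψ⟫ :=
  exists_inner_eq_of_norm_le b ψ fun n => by
    rw [norm_mul]
    exact mul_le_of_le_one_left (norm_nonneg _) (hc n)

/-- Multiplication of the `n`-th coefficient by `e^{iθ_n}`. -/
def diagonalPhase (θ : ℕ → ℝ) : E →ₗᵢ[ℂ] E :=
  have hn : ∀ n, ‖Complex.exp (θ n * Complex.I)‖ ≤ 1 := fun n =>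
    (Complex.norm_exp_ofReal_mul_I _).le
  { toFun := fun ψ => (exists_inner_eq_mul b hn ψ).choose
    map_add' := fun ψ χ => hilbertBasis_ext b fun n => by
      rw [inner_add_right, (exists_inner_eq_mul b hn ψ).choose_spec n,
        (exists_inner_eq_mul b hn χ).choose_spec n, (exists_inner_eq_mul b hn _).choose_spec n,
        inner_add_right, mul_add]
    map_smul' := fun c ψ => hilbertBasis_ext b fun n => by
      rw [inner_smul_right, RingHom.id_apply, (exists_inner_eq_mul b hn ψ).choose_spec n,
        (exists_inner_eq_mul b hn _).choose_spec n, inner_smul_right]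
      ring
    norm_map' := fun ψ => by
      have h1 := hasSum_sq_norm_inner b (exists_inner_eq_mul b hn ψ).choose
      have h2 := hasSum_sq_norm_inner b ψ
      simp only [(exists_inner_eq_mul b hn ψ).choose_spec, norm_mul,
        Complex.norm_exp_ofReal_mul_I, one_mul] at h1
      exact (pow_left_inj₀ (norm_nonneg _) (norm_nonneg _) two_ne_zero).1 (h1.unique h2) }

theorem inner_diagonalPhase (θ : ℕ → ℝ) (ψ : E) (n : ℕ) :
    ⟪b n, diagonalPhase b θ ψ⟫ = Complex.exp (θ n * Complex.I) * ⟪b n, ψ⟫ :=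
  (exists_inner_eq_mul b (fun n => (Complex.norm_exp_ofReal_mul_I (θ n)).le) ψ).choose_spec n

/-- The unitary group with eigenvectors `b n` and eigenvalues `e^{itλ_n}`. -/
def diagonalGroup (lam : ℕ → ℝ) : ℝ → unitary (E →L[ℂ] E) :=
  unitaryGroup (fun t => diagonalPhase b fun n => t * lam n)
    (fun ψ => hilbertBasis_ext b fun n => by simp [inner_diagonalPhase])
    (fun s t ψ => hilbertBasis_ext b fun n => by
      simp only [inner_diagonalPhase, ← mul_assoc, ← Complex.exp_add]
      congr 2
      push_cast
      ring)

theorem inner_diagonalGroup (lam : ℕ → ℝ) (t : ℝ) (ψ : E) (n : ℕ) :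
    ⟪b n, (diagonalGroup b lam t : E →L[ℂ] E) ψ⟫ =
      Complex.exp ((t * lam n : ℝ) * Complex.I) * ⟪b n, ψ⟫ :=
  inner_diagonalPhase b _ ψ n

theorem norm_exp_mul_I_sub_le (s t : ℝ) :
    ‖Complex.exp (s * Complex.I) - Complex.exp (t * Complex.I)‖ ≤ 2 := by
  refine (norm_sub_le _ _).trans ?_
  rw [Complex.norm_exp_ofReal_mul_I, Complex.norm_exp_ofReal_mul_I]
  norm_num

theorem tendsto_phase_slope (y : ℝ) :
    Tendsto (fun t : ℝ => (t : ℂ)⁻¹ * (Complex.exp ((t * y : ℝ) * Complex.I) - 1)) (𝓝[≠] 0)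
      (𝓝 (Complex.I * y)) := by
  have h : HasDerivAt (fun t : ℝ => Complex.exp ((t * y : ℝ) * Complex.I))
      (Complex.exp ((0 * y : ℝ) * Complex.I) * ((1 * y : ℝ) * Complex.I)) 0 :=
    ((((hasDerivAt_id (0 : ℝ)).mul_const y).ofReal_comp).mul_const Complex.I).cexp
  rw [hasDerivAt_iff_tendsto_slope_zero] at h
  simp only [zero_add, zero_mul, Complex.ofReal_zero, Complex.exp_zero, one_mul] at h
  rw [mul_comm]
  refine h.congr fun t => ?_
  rw [← Complex.ofReal_inv, Complex.real_smul]

/-- The bound is uniform in `t`, so the difference quotients of `e^{itA}` are dominated by `|Aψ|`,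
coefficientwise for diagonal operators and pointwise for `Q`. At `t = 0` the inverse is `0` by
convention. -/
theorem norm_phase_slope_le (t y : ℝ) :
    ‖(t : ℂ)⁻¹ * (Complex.exp ((t * y : ℝ) * Complex.I) - 1)‖ ≤ |y| := by
  rcases eq_or_ne t 0 with rfl | ht
  · simp
  rw [norm_mul, norm_inv, Complex.norm_real, Real.norm_eq_abs, inv_mul_le_iff₀ (abs_pos.2 ht),
    ← abs_mul]
  have := Real.norm_exp_I_mul_ofReal_sub_one_le (x := t * y)
  rwa [mul_comm Complex.I] at this

/-- On the graph the difference quotients converge by dominated convergence. Conversely, a limit in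
norm forces convergence of each coefficient, which determines `χ` and places `ψ` in the domain. -/
theorem isUnitaryGroupOf_diagonal {A : E →ₗ.[ℂ] E} (lam : ℕ → ℝ)
    (h : ∀ ψ χ, (ψ, χ) ∈ A.graph ↔ ∀ n, ⟪b n, χ⟫ = lam n * ⟪b n, ψ⟫) :
    IsUnitaryGroupOf A (diagonalGroup b lam) where
  add := unitaryGroup_add _ _ _
  continuous ψ := by
    rw [continuous_iff_continuousAt]
    intro s
    refine tendsto_of_dominated_inner b ((2 : ℂ) • ψ) (Eventually.of_forall fun t n => ?_)
      fun n => ?_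
    · rw [inner_diagonalGroup, inner_diagonalGroup, ← sub_mul, norm_mul, inner_smul_right,
        norm_mul]
      exact mul_le_mul_of_nonneg_right ((norm_exp_mul_I_sub_le _ _).trans (by norm_num))
        (norm_nonneg _)
    · simp only [inner_diagonalGroup]
      exact (Continuous.tendsto (by fun_prop) s)
  generator ψ χ := by
    have hc : ∀ (t : ℝ) n, ⟪b n, (t : ℂ)⁻¹ • ((diagonalGroup b lam t : E →L[ℂ] E) ψ - ψ)⟫ =
        ((t : ℂ)⁻¹ * (Complex.exp ((t * lam n : ℝ) * Complex.I) - 1)) * ⟪b n, ψ⟫ := fun t n => by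
      rw [inner_smul_right, inner_sub_right, inner_diagonalGroup]
      ring
    rw [h]
    constructor
    · intro H
      -- Quotient and limit are each bounded by the coefficients of `χ`, whence the factor 2.
      refine tendsto_of_dominated_inner b ((2 : ℂ) • χ) (Eventually.of_forall fun t n => ?_)
        fun n => ?_
      · refine (norm_sub_le _ _).trans ?_
        rw [hc, inner_smul_right, inner_smul_right, norm_mul, norm_mul _ ⟪b n, χ⟫,
          norm_mul _ ⟪b n, χ⟫, Complex.norm_I, one_mul, Complex.norm_ofNat, two_mul]
        gcongr
        rw [H n, norm_mul (lam n : ℂ), Complex.norm_real]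
        refine mul_le_mul_of_nonneg_right ?_ (norm_nonneg ⟪b n, ψ⟫)
        simpa using norm_phase_slope_le t (lam n)
      · simp only [hc]
        rw [inner_smul_right, H n, ← mul_assoc]
        exact (tendsto_phase_slope (lam n)).mul_const _
    · intro H n
      have h1 := (tendsto_phase_slope (lam n)).mul_const ⟪b n, ψ⟫
      have h2 : Tendsto (fun t : ℝ => ⟪b n, (t : ℂ)⁻¹ •
          ((diagonalGroup b lam t : E →L[ℂ] E) ψ - ψ)⟫) (𝓝[≠] 0) (𝓝 ⟪b n, Complex.I • χ⟫) :=
        tendsto_const_nhds.inner H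
      simp only [hc] at h2
      have h3 := tendsto_nhds_unique h1 h2
      rw [inner_smul_right, mul_assoc] at h3
      exact (mul_left_cancel₀ Complex.I_ne_zero h3).symm

/-! ### Ladder operators -/

/-- The closed operator `A` lowers the Hilbert basis `b`: `A b_{n+1} = √(n+1) b_n`. -/
def IsLowering (A : E →ₗ.[ℂ] E) : Prop :=
  ∀ ψ χ, (ψ, χ) ∈ A.graph ↔ ∀ n : ℕ, ⟪b n, χ⟫ = (√(n + 1) : ℝ) * ⟪b (n + 1), ψ⟫

/-- Square summability of `√(n+1) c_{n+1}` implies that of `√(n+1) c_n`: the domain of a lowering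
operator lies in that of its adjoint. -/
theorem exists_raised {ψ χ : E}
    (hχ : ∀ n : ℕ, ⟪b n, χ⟫ = (√(n + 1) : ℝ) * ⟪b (n + 1), ψ⟫) :
    ∃ τ : E, ⟪b 0, τ⟫ = 0 ∧ ∀ n : ℕ, ⟪b (n + 1), τ⟫ = (√(n + 1) : ℝ) * ⟪b n, ψ⟫ := by
  have hs : Summable fun n : ℕ => ‖((√(n + 1) : ℝ) : ℂ) * ⟪b n, ψ⟫‖ ^ 2 := by
    rw [← summable_nat_add_iff 1]
    -- After the shift the comparison is `n + 2 ≤ 4 (n + 1)`.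
    refine ((hasSum_sq_norm_inner b χ).summable.mul_left 4).of_nonneg_of_le
      (fun _ => by positivity) fun n => ?_
    rw [hχ n, norm_mul, norm_mul, Complex.norm_real, Complex.norm_real, mul_pow, mul_pow,
      Real.norm_of_nonneg (Real.sqrt_nonneg _), Real.norm_of_nonneg (Real.sqrt_nonneg _),
      Real.sq_sqrt (by positivity), Real.sq_sqrt (by positivity), ← mul_assoc]
    gcongr
    push_cast
    linarith [(Nat.cast_nonneg n : (0 : ℝ) ≤ n)]
  obtain ⟨τ, hτ⟩ := exists_inner_eq b
    (c := fun n => Nat.casesOn n 0 fun k => (√(k + 1) : ℝ) * ⟪b k, ψ⟫) (by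
      rw [← summable_nat_add_iff 1]
      exact hs)
  exact ⟨τ, hτ 0, fun n => hτ (n + 1)⟩

variable {b} {A : E →ₗ.[ℂ] E}

theorem IsLowering.basis_zero_mem (h : IsLowering b A) : (b 0, 0) ∈ A.graph := by
  rw [h]
  intro n
  rw [orthonormal_iff_ite.1 b.orthonormal]
  simp

theorem IsLowering.basis_succ_mem (h : IsLowering b A) (k : ℕ) :
    (b (k + 1), ((√(k + 1) : ℝ) : ℂ) • b k) ∈ A.graph := by
  rw [h]
  intro n
  rw [inner_smul_right, orthonormal_iff_ite.1 b.orthonormal, orthonormal_iff_ite.1 b.orthonormal]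
  by_cases hn : n = k <;> simp [hn]

theorem IsLowering.dense (h : IsLowering b A) : Dense (A.domain : Set E) :=
  dense_of_hilbertBasis_mem b fun n => by
    cases n with
    | zero => exact LinearPMap.mem_domain_of_mem_graph h.basis_zero_mem
    | succ k => exact LinearPMap.mem_domain_of_mem_graph (h.basis_succ_mem k)

theorem IsLowering.mem_adjoint_graph (h : IsLowering b A) {ψ χ : E} :
    (ψ, χ) ∈ A†.graph ↔
      ⟪b 0, χ⟫ = 0 ∧ ∀ n : ℕ, ⟪b (n + 1), χ⟫ = (√(n + 1) : ℝ) * ⟪b n, ψ⟫ := by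
  rw [mem_adjoint_graph_iff h.dense]
  constructor
  · intro H
    constructor
    · have := H _ _ h.basis_zero_mem
      rw [inner_zero_right] at this
      rw [← inner_conj_symm, this, map_zero]
    · intro n
      have := congrArg conj (H _ _ (h.basis_succ_mem n))
      rwa [inner_conj_symm, inner_conj_symm, inner_smul_left, Complex.conj_ofReal] at this
  · rintro ⟨H0, H⟩ ξ τ hξ
    rw [h] at hξ
    -- In Parseval's formula the zeroth term vanishes, which aligns the raised coefficients of `χ`
    -- with the lowered ones of `τ`.
    rw [← b.tsum_inner_mul_inner, ← b.tsum_inner_mul_inner,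
      (b.summable_inner_mul_inner χ ξ).tsum_eq_zero_add, ← inner_conj_symm χ, H0, map_zero,
      zero_mul, zero_add]
    congr 1
    funext n
    rw [hξ n, ← inner_conj_symm χ, H n, map_mul, Complex.conj_ofReal, inner_conj_symm]
    ring

/-- Both domains consist of the vectors whose coefficients satisfy `∑ n |c_n|² < ∞`. -/
theorem IsLowering.adjoint_domain (h : IsLowering b A) : A†.domain = A.domain := by
  ext ψ
  rw [LinearPMap.mem_domain_iff, LinearPMap.mem_domain_iff]
  constructor
  · rintro ⟨χ, hχ⟩
    rw [h.mem_adjoint_graph] at hχ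
    have hs := (hasSum_sq_norm_inner b χ).summable
    -- The coefficient `√(n+1) c_{n+1}` of `Aψ` is compared with the coefficient `√(n+2) c_{n+1}` of
    -- `A†ψ`, which sits at index `n + 2`.
    rw [← summable_nat_add_iff 2] at hs
    obtain ⟨τ, hτ⟩ := exists_inner_eq b (c := fun n => (√(n + 1) : ℝ) * ⟪b (n + 1), ψ⟫)
      (hs.of_nonneg_of_le (fun _ => by positivity) fun n => by
        refine pow_le_pow_left₀ (norm_nonneg _) ?_ 2
        rw [hχ.2 (n + 1), norm_mul, norm_mul, Complex.norm_real, Complex.norm_real,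
          Real.norm_of_nonneg (Real.sqrt_nonneg _), Real.norm_of_nonneg (Real.sqrt_nonneg _)]
        gcongr
        simp)
    exact ⟨τ, (h _ _).2 hτ⟩
  · rintro ⟨χ, hχ⟩
    obtain ⟨τ, hτ⟩ := exists_raised b ((h _ _).1 hχ)
    exact ⟨τ, h.mem_adjoint_graph.2 hτ⟩

theorem mem_opMul_graph {B A : E →ₗ.[ℂ] E} {ψ τ : E} :
    (ψ, τ) ∈ (opMul B A).graph ↔ ∃ χ, (ψ, χ) ∈ A.graph ∧ (χ, τ) ∈ B.graph := by
  constructor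
  · intro h
    obtain ⟨u, rfl, rfl⟩ := (opMul B A).mem_graph_iff.1 h
    obtain ⟨h1, h2⟩ := (mem_opMul_domain B A _).1 u.2
    exact ⟨A ⟨u, h1⟩, A.mem_graph ⟨u, h1⟩, B.mem_graph ⟨_, h2⟩⟩
  · rintro ⟨χ, h1, h2⟩
    obtain ⟨u, rfl, rfl⟩ := A.mem_graph_iff.1 h1
    obtain ⟨v, hv, rfl⟩ := B.mem_graph_iff.1 h2
    have hv' : (v : E) = A u := hv
    have hm : A u ∈ B.domain := hv' ▸ v.2
    have hd : (u : E) ∈ (opMul B A).domain := (mem_opMul_domain B A _).2 ⟨u.2, hm⟩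
    refine (opMul B A).mem_graph_iff.2 ⟨⟨u, hd⟩, rfl, ?_⟩
    change B ⟨A u, hm⟩ = B v
    congr 1
    exact Subtype.ext hv'.symm

/-- The natural domain of the product is no smaller than the maximal diagonal domain: if `n c_n` is
square summable, so is `√(n+1) c_{n+1}`, and the intermediate vector `Aψ` exists. -/
theorem IsLowering.mem_number_graph (h : IsLowering b A) {ψ χ : E} :
    (ψ, χ) ∈ (opMul A† A).graph ↔ ∀ n : ℕ, ⟪b n, χ⟫ = (n : ℝ) * ⟪b n, ψ⟫ := by
  have hsq : ∀ n : ℕ, ((√(n + 1) : ℝ) : ℂ) * (√(n + 1) : ℝ) = (n : ℂ) + 1 := fun n => by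
    rw [← Complex.ofReal_mul, Real.mul_self_sqrt (by positivity)]
    push_cast
    rfl
  rw [mem_opMul_graph]
  constructor
  · rintro ⟨τ, h1, h2⟩ n
    rw [h] at h1
    rw [h.mem_adjoint_graph] at h2
    cases n with
    | zero => simp [h2.1]
    | succ n =>
      rw [h2.2, h1, ← mul_assoc, hsq]
      push_cast
      rfl
  · intro H
    have hs := (hasSum_sq_norm_inner b χ).summable
    rw [← summable_nat_add_iff 1] at hs
    obtain ⟨τ, hτ⟩ := exists_inner_eq b (c := fun n => (√(n + 1) : ℝ) * ⟪b (n + 1), ψ⟫)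
      (hs.of_nonneg_of_le (fun _ => by positivity) fun n => by
        refine pow_le_pow_left₀ (norm_nonneg _) ?_ 2
        rw [H (n + 1), norm_mul, norm_mul, Complex.norm_real, Complex.norm_real,
          Real.norm_of_nonneg (Real.sqrt_nonneg _), Real.norm_of_nonneg (by positivity)]
        gcongr
        push_cast
        rw [Real.sqrt_le_left (by positivity)]
        nlinarith [(Nat.cast_nonneg n : (0 : ℝ) ≤ n)])
    refine ⟨τ, (h _ _).2 hτ, h.mem_adjoint_graph.2 ⟨by rw [H 0]; simp, fun n => ?_⟩⟩
    rw [H (n + 1), hτ, ← mul_assoc, hsq]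
    push_cast
    rfl

end Abstract

end


/-! ### The groups generated by position and momentum on `L²(ℝ)`. -/

noncomputable section

/-! ### Square integrable functions on the line -/

theorem norm_sq_eq_integral (ψ : OscSpace) : ‖ψ‖ ^ 2 = ∫ x, ‖ψ x‖ ^ 2 := by
  have h := L2.inner_def (𝕜 := ℂ) ψ ψ
  rw [inner_self_eq_norm_sq_to_K] at h
  simp only [inner_self_eq_norm_sq_to_K] at h
  have h2 : ((‖ψ‖ ^ 2 : ℝ) : ℂ) = ((∫ x, ‖ψ x‖ ^ 2 : ℝ) : ℂ) := by
    rw [← integral_complex_ofReal]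
    push_cast
    exact h
  exact_mod_cast h2

theorem integrable_sq_norm (ψ : OscSpace) : Integrable fun x => ‖ψ x‖ ^ 2 :=
  (memLp_two_iff_integrable_sq_norm (Lp.memLp ψ).1).1 (Lp.memLp ψ)

/-- Dominated convergence in `L²`. -/
theorem tendsto_of_dominated_ae {ι : Type*} {l : Filter ι} [l.IsCountablyGenerated]
    {ψ : ι → OscSpace} {F : ι → ℝ → ℂ} {χ : OscSpace} (ξ : OscSpace)
    (hF : ∀ i, ψ i =ᵐ[volume] F i)
    (hb : ∀ᵐ x, ∀ i, ‖F i x - χ x‖ ≤ ‖ξ x‖)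
    (hp : ∀ᵐ x, Tendsto (fun i => F i x) l (𝓝 (χ x))) : Tendsto ψ l (𝓝 χ) := by
  have hsub : ∀ i, ∀ᵐ x, ‖(ψ i - χ) x‖ ^ 2 = ‖F i x - χ x‖ ^ 2 := fun i => by
    filter_upwards [hF i, Lp.coeFn_sub (ψ i) χ] with x h1 h2
    rw [h2, Pi.sub_apply, h1]
  rw [tendsto_iff_norm_sub_tendsto_zero]
  have h : Tendsto (fun i => ‖ψ i - χ‖ ^ 2) l (𝓝 0) := by
    have := tendsto_integral_filter_of_dominated_convergence (μ := (volume : Measure ℝ)) (l := l)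
      (F := fun i x => ‖F i x - χ x‖ ^ 2) (f := fun _ => 0) (fun x => ‖ξ x‖ ^ 2)
      (Eventually.of_forall fun i =>
        (integrable_sq_norm (ψ i - χ)).1.congr (hsub i))
      (Eventually.of_forall fun i => by
        filter_upwards [hb] with x hx
        rw [Real.norm_of_nonneg (by positivity)]
        exact pow_le_pow_left₀ (norm_nonneg _) (hx i) 2)
      (integrable_sq_norm ξ) (by
        filter_upwards [hp] with x hx
        have := (hx.sub_const (χ x)).norm.pow 2
        simpa using this)
    rw [integral_zero] at this
    refine this.congr fun i => ?_
    rw [norm_sq_eq_integral]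
    exact (integral_congr_ae (hsub i)).symm
  simpa using h.sqrt

/-- An `L²`-convergent family has a sequence along the filter that converges almost everywhere, so
its limit must be the pointwise one. -/
theorem ae_eq_of_tendsto {ι : Type*} {l : Filter ι} [l.IsCountablyGenerated] [l.NeBot]
    {ψ : ι → OscSpace} {F : ι → ℝ → ℂ} {χ : OscSpace} {k : ℝ → ℂ}
    (hF : ∀ i, ψ i =ᵐ[volume] F i) (hψ : Tendsto ψ l (𝓝 χ))
    (hp : ∀ᵐ x, Tendsto (fun i => F i x) l (𝓝 (k x))) : χ =ᵐ[volume] k := by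
  obtain ⟨ns, h1, h2⟩ := (tendstoInMeasure_of_tendsto_Lp hψ).exists_seq_tendsto_ae'
  filter_upwards [h2, hp, ae_all_iff.2 fun n => hF (ns n)] with x hx1 hx2 hx3
  simp only [hx3] at hx1
  exact tendsto_nhds_unique hx1 (hx2.comp h1)

/-! ### The group generated by the position operator -/

theorem mem_positionOp_graph {ψ χ : OscSpace} :
    (ψ, χ) ∈ positionOp.graph ↔ χ =ᵐ[volume] fun x => (x : ℂ) * ψ x := by
  rw [LinearPMap.mem_graph_iff]
  constructor
  · rintro ⟨u, rfl, rfl⟩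
    exact MemLp.coeFn_toLp u.2
  · intro h
    have hm : MemLp (fun x : ℝ => (x : ℂ) * ψ x) 2 volume := (Lp.memLp χ).ae_eq h
    exact ⟨⟨ψ, hm⟩, rfl, Lp.ext ((MemLp.coeFn_toLp hm).trans h.symm)⟩

theorem memLp_phase_mul (t : ℝ) (ψ : OscSpace) :
    MemLp (fun x : ℝ => Complex.exp ((t * x : ℝ) * Complex.I) * ψ x) 2 volume := by
  refine (Lp.memLp ψ).of_le ?_ (Eventually.of_forall fun x => ?_)
  · exact (Continuous.aestronglyMeasurable (by fun_prop)).mul (Lp.memLp ψ).1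
  · rw [norm_mul, Complex.norm_exp_ofReal_mul_I, one_mul]

/-- Multiplication by `e^{itx}`. -/
def phaseMul (t : ℝ) : OscSpace →ₗᵢ[ℂ] OscSpace where
  toFun ψ := (memLp_phase_mul t ψ).toLp _
  map_add' ψ χ := by
    apply Lp.ext
    filter_upwards [Lp.coeFn_add ψ χ, (memLp_phase_mul t ψ).coeFn_toLp,
      (memLp_phase_mul t χ).coeFn_toLp, (memLp_phase_mul t (ψ + χ)).coeFn_toLp,
      Lp.coeFn_add ((memLp_phase_mul t ψ).toLp _) ((memLp_phase_mul t χ).toLp _)]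
      with x h1 h2 h3 h4 h5
    rw [h4, h5, Pi.add_apply, h2, h3, h1, Pi.add_apply, mul_add]
  map_smul' c ψ := by
    apply Lp.ext
    filter_upwards [Lp.coeFn_smul c ψ, (memLp_phase_mul t ψ).coeFn_toLp,
      (memLp_phase_mul t (c • ψ)).coeFn_toLp,
      Lp.coeFn_smul c ((memLp_phase_mul t ψ).toLp _)] with x h1 h2 h3 h4
    rw [h3, RingHom.id_apply, h4, Pi.smul_apply, h2, h1, Pi.smul_apply, smul_eq_mul, smul_eq_mul]
    ring
  norm_map' ψ := by
    refine (pow_left_inj₀ (norm_nonneg _) (norm_nonneg _) two_ne_zero).1 ?_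
    rw [norm_sq_eq_integral, norm_sq_eq_integral]
    refine integral_congr_ae ?_
    filter_upwards [(memLp_phase_mul t ψ).coeFn_toLp] with x hx
    change ‖((memLp_phase_mul t ψ).toLp _ : OscSpace) x‖ ^ 2 = _
    rw [hx, norm_mul, Complex.norm_exp_ofReal_mul_I, one_mul]

theorem coeFn_phaseMul (t : ℝ) (ψ : OscSpace) :
    phaseMul t ψ =ᵐ[volume] fun x => Complex.exp ((t * x : ℝ) * Complex.I) * ψ x :=
  (memLp_phase_mul t ψ).coeFn_toLp

/-- The unitary group `e^{itQ}`. -/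
def positionGroup : ℝ → unitary (OscSpace →L[ℂ] OscSpace) :=
  unitaryGroup phaseMul
    (fun ψ => by
      apply Lp.ext
      filter_upwards [coeFn_phaseMul 0 ψ] with x hx
      simp [hx])
    (fun s t ψ => by
      apply Lp.ext
      filter_upwards [coeFn_phaseMul (s + t) ψ, coeFn_phaseMul s (phaseMul t ψ),
        coeFn_phaseMul t ψ] with x h1 h2 h3
      rw [h1, h2, h3, ← mul_assoc, ← Complex.exp_add]
      congr 2
      push_cast
      ring)

theorem positionGroup_apply (t : ℝ) (ψ : OscSpace) :
    (positionGroup t : OscSpace →L[ℂ] OscSpace) ψ = phaseMul t ψ := rfl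

/-- The continuous analogue of `isUnitaryGroupOf_diagonal`, with `x` as eigenvalue. In the converse
direction the `L²` limit of the quotients is identified with the pointwise limit `i x ψ(x)`, which
is therefore square integrable. -/
theorem isUnitaryGroupOf_positionOp : IsUnitaryGroupOf positionOp positionGroup where
  add := unitaryGroup_add _ _ _
  continuous ψ := by
    rw [continuous_iff_continuousAt]
    intro s
    refine tendsto_of_dominated_ae ((2 : ℂ) • ψ) (fun t => coeFn_phaseMul t ψ) ?_ ?_
    · filter_upwards [coeFn_phaseMul s ψ, Lp.coeFn_smul (2 : ℂ) ψ] with x h1 h2 t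
      rw [positionGroup_apply, h1, h2, ← sub_mul, norm_mul, Pi.smul_apply, smul_eq_mul, norm_mul]
      exact mul_le_mul_of_nonneg_right ((norm_exp_mul_I_sub_le _ _).trans (by norm_num))
        (norm_nonneg _)
    · filter_upwards [coeFn_phaseMul s ψ] with x h1
      rw [positionGroup_apply, h1]
      exact Continuous.tendsto (by fun_prop) s
  generator ψ χ := by
    have hc : ∀ t : ℝ, ((t : ℂ)⁻¹ • ((positionGroup t : OscSpace →L[ℂ] OscSpace) ψ - ψ) :
        OscSpace) =ᵐ[volume]
        fun x => ((t : ℂ)⁻¹ * (Complex.exp ((t * x : ℝ) * Complex.I) - 1)) * ψ x := fun t => by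
      filter_upwards [Lp.coeFn_smul (t : ℂ)⁻¹ (phaseMul t ψ - ψ),
        Lp.coeFn_sub (phaseMul t ψ) ψ, coeFn_phaseMul t ψ] with x h1 h2 h3
      rw [positionGroup_apply, h1, Pi.smul_apply, h2, Pi.sub_apply, h3, smul_eq_mul]
      ring
    rw [mem_positionOp_graph]
    constructor
    · intro H
      refine tendsto_of_dominated_ae ((2 : ℂ) • χ) hc ?_ ?_
      · filter_upwards [H, Lp.coeFn_smul (2 : ℂ) χ, Lp.coeFn_smul Complex.I χ] with x h1 h2 h3 t
        refine (norm_sub_le _ _).trans ?_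
        rw [h2, h3, Pi.smul_apply, Pi.smul_apply, smul_eq_mul, smul_eq_mul,
          norm_mul Complex.I, norm_mul 2, Complex.norm_I, one_mul, Complex.norm_ofNat, two_mul]
        gcongr
        rw [h1, norm_mul (x : ℂ), Complex.norm_real, norm_mul _ (ψ x)]
        exact mul_le_mul_of_nonneg_right (norm_phase_slope_le t x) (norm_nonneg _)
      · filter_upwards [H, Lp.coeFn_smul Complex.I χ] with x h1 h2
        rw [h2, Pi.smul_apply, h1, smul_eq_mul, ← mul_assoc]
        exact (tendsto_phase_slope x).mul_const _
    · intro H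
      have h1 := ae_eq_of_tendsto hc H (k := fun x => Complex.I * x * ψ x)
        (Eventually.of_forall fun x => (tendsto_phase_slope x).mul_const _)
      filter_upwards [h1, Lp.coeFn_smul Complex.I χ] with x h2 h3
      rw [h3, Pi.smul_apply, smul_eq_mul, mul_assoc] at h2
      exact mul_left_cancel₀ Complex.I_ne_zero h2

/-! ### Translations and the weak derivative -/

/-- The translation `ψ(x) ↦ ψ(x + t)`. -/
def translate (t : ℝ) : OscSpace →ₗᵢ[ℂ] OscSpace :=
  Lp.compMeasurePreservingₗᵢ ℂ (fun x => x + t) (measurePreserving_add_right volume t)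

theorem coeFn_translate (t : ℝ) (ψ : OscSpace) :
    translate t ψ =ᵐ[volume] fun x => ψ (x + t) :=
  Lp.coeFn_compMeasurePreserving ψ (measurePreserving_add_right volume t)

theorem translate_zero (ψ : OscSpace) : translate 0 ψ = ψ := by
  apply Lp.ext
  filter_upwards [coeFn_translate 0 ψ] with x hx
  rw [hx, add_zero]

theorem translate_add (s t : ℝ) (ψ : OscSpace) :
    translate (s + t) ψ = translate s (translate t ψ) := by
  apply Lp.ext
  filter_upwards [coeFn_translate (s + t) ψ, coeFn_translate s (translate t ψ),
    (measurePreserving_add_right volume s).quasiMeasurePreserving.ae (coeFn_translate t ψ)]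
    with x h1 h2 h3
  rw [h1, h2, h3, add_assoc]

theorem continuous_translate (ψ : OscSpace) : Continuous fun t => translate t ψ := by
  have hg : Continuous fun t : ℝ => (⟨fun x => x + t, by fun_prop⟩ : C(ℝ, ℝ)) :=
    ContinuousMap.continuous_of_continuous_uncurry _ (by
      change Continuous fun p : ℝ × ℝ => p.2 + p.1
      fun_prop)
  exact (continuous_const (y := ψ)).compMeasurePreservingLp hg
    (fun t => measurePreserving_add_right volume t) (by norm_num)

theorem memLp_ofReal_of_hasCompactSupport {g : ℝ → ℝ} (hg : Continuous g)
    (hs : HasCompactSupport g) : MemLp (fun x => (g x : ℂ)) 2 (volume : Measure ℝ) :=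
  (hg.memLp_of_hasCompactSupport hs).ofReal

/-- The element of `L²` given by a continuous function with compact support. -/
def testVector (g : ℝ → ℝ) (hg : Continuous g) (hs : HasCompactSupport g) : OscSpace :=
  (memLp_ofReal_of_hasCompactSupport hg hs).toLp _

theorem inner_testVector {g : ℝ → ℝ} (hg : Continuous g) (hs : HasCompactSupport g)
    (ψ : OscSpace) : inner ℂ (testVector g hg hs) ψ = ∫ x, g x • ψ x := by
  rw [L2.inner_def]
  refine integral_congr_ae ?_
  filter_upwards [(memLp_ofReal_of_hasCompactSupport hg hs).coeFn_toLp] with x hx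
  rw [testVector, RCLike.inner_apply, hx]
  simp [mul_comm]

theorem eq_of_forall_inner_testVector {ψ χ : OscSpace}
    (h : ∀ (g : ℝ → ℝ) (hg : ContDiff ℝ ∞ g) (hs : HasCompactSupport g),
      inner ℂ (testVector g hg.continuous hs) ψ = inner ℂ (testVector g hg.continuous hs) χ) :
    ψ = χ := by
  rw [← sub_eq_zero]
  refine (Lp.eq_zero_iff_ae_eq_zero).2 (ae_eq_zero_of_integral_contDiff_smul_eq_zero
    ((Lp.memLp (ψ - χ)).locallyIntegrable (by norm_num)) fun g hg hs => ?_)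
  rw [← inner_testVector hg.continuous hs, inner_sub_right, h g hg hs, sub_self]

theorem inner_testVector_translate {g : ℝ → ℝ} (hg : Continuous g) (hs : HasCompactSupport g)
    (ψ : OscSpace) (t : ℝ) :
    inner ℂ (testVector g hg hs) (translate t ψ) = ∫ x, g (x - t) • ψ x := by
  rw [inner_testVector, ← integral_add_right_eq_self (fun x => g (x - t) • ψ x) t]
  refine integral_congr_ae ?_
  filter_upwards [coeFn_translate t ψ] with x hx
  rw [hx, add_sub_cancel_right]

/-- Moving the shift onto `g` turns the pairing into a convolution of `ψ` with the smooth compactly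
supported function `y ↦ g(-y)`, so no regularity of `ψ` is needed. -/
theorem hasDerivAt_inner_testVector_translate {g : ℝ → ℝ} (hg : ContDiff ℝ ∞ g)
    (hs : HasCompactSupport g) (ψ : OscSpace) (t : ℝ) :
    HasDerivAt (fun s => inner ℂ (testVector g hg.continuous hs) (translate s ψ))
      (-∫ x, deriv g (x - t) • ψ x) t := by
  have hs' : HasCompactSupport fun y => g (-y) := hs.comp_homeomorph (Homeomorph.neg ℝ)
  have h := hs'.hasDerivAt_convolution_right ((ContinuousLinearMap.lsmul ℝ ℝ).flip)
    (μ := (volume : Measure ℝ)) ((Lp.memLp ψ).locallyIntegrable (by norm_num))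
    ((hg.comp contDiff_neg).of_le (by simp)) t
  convert! h using 1
  · funext s
    rw [inner_testVector_translate]
    refine integral_congr_ae (Eventually.of_forall fun x => ?_)
    simp
  · rw [← integral_neg]
    refine integral_congr_ae (Eventually.of_forall fun x => ?_)
    simp [deriv_comp_neg]

theorem real_smul_eq (t : ℝ) (ψ : OscSpace) : t • ψ = (t : ℂ) • ψ := by
  apply Lp.ext
  filter_upwards [Lp.coeFn_smul t ψ, Lp.coeFn_smul (t : ℂ) ψ] with x h1 h2
  rw [h1, h2, Pi.smul_apply, Pi.smul_apply, Complex.coe_smul]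

/-- The weak derivative is the generator of translations. If `ψ' = χ` weakly, then `T_t ψ - ψ = ∫₀ᵗ
T_u χ du`, and strong continuity of `T` allows differentiation at `0`. The converse follows by
pairing the limit with test functions. -/
theorem mem_weakDerivGraph_iff_tendsto {ψ χ : OscSpace} :
    (ψ, χ) ∈ weakDerivGraph ↔
      Tendsto (fun t : ℝ => t⁻¹ • (translate t ψ - ψ)) (𝓝[≠] 0) (𝓝 χ) := by
  constructor
  · intro H
    have hd : ∀ (g : ℝ → ℝ) (hg : ContDiff ℝ ∞ g) (hs : HasCompactSupport g) (t : ℝ),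
        HasDerivAt (fun s => inner ℂ (testVector g hg.continuous hs) (translate s ψ))
          (inner ℂ (testVector g hg.continuous hs) (translate t χ)) t := by
      intro g hg hs t
      convert! hasDerivAt_inner_testVector_translate hg hs ψ t using 1
      rw [inner_testVector_translate]
      have := H (fun x => g (x - t)) (hg.comp (contDiff_id.sub contDiff_const))
        (hs.comp_homeomorph (Homeomorph.subRight t))
      simp only [deriv_comp_sub_const] at this
      rw [this, neg_neg]
    have hI : ∀ t, HasDerivAt (fun s => ∫ u in (0 : ℝ)..s, translate u χ) (translate t χ) t :=
      fun t => intervalIntegral.integral_hasDerivAt_right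
        ((continuous_translate χ).intervalIntegrable _ _)
        ((continuous_translate χ).stronglyMeasurableAtFilter _ _)
        (continuous_translate χ).continuousAt
    -- Paired with any test function, the left side has zero derivative in `t`; it is thus constant
    -- and equals its value at `0`.
    have heq : ∀ t, translate t ψ - ∫ u in (0 : ℝ)..t, translate u χ = ψ := by
      intro t
      refine eq_of_forall_inner_testVector fun g hg hs => ?_
      have h0 : ∀ s, HasDerivAt (fun s => inner ℂ (testVector g hg.continuous hs)
          (translate s ψ - ∫ u in (0 : ℝ)..s, translate u χ)) 0 s := by
        intro s
        simp only [inner_sub_right]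
        have h1 := (hasDerivAt_const s (testVector g hg.continuous hs)).inner ℂ (hI s)
        rw [inner_zero_left, add_zero] at h1
        have h4 := (hd g hg hs s).sub h1
        rwa [sub_self] at h4
      have h1 := is_const_of_deriv_eq_zero (fun s => (h0 s).differentiableAt)
        (fun s => (h0 s).deriv) t 0
      rw [h1, intervalIntegral.integral_same, sub_zero, translate_zero]
    have h2 : HasDerivAt (fun t => translate t ψ) χ 0 := by
      have h3 := (hI 0).add_const ψ
      rw [translate_zero] at h3
      refine h3.congr_of_eventuallyEq (Eventually.of_forall fun t => ?_)
      change translate t ψ = (∫ u in (0 : ℝ)..t, translate u χ) + ψ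
      nth_rewrite 2 [← heq t]
      abel
    rw [hasDerivAt_iff_tendsto_slope_zero] at h2
    simpa only [zero_add, translate_zero] using h2
  · intro H g hg hs
    have h1 := hasDerivAt_inner_testVector_translate hg hs ψ 0
    rw [hasDerivAt_iff_tendsto_slope_zero] at h1
    have h2 : Tendsto (fun t : ℝ => inner ℂ (testVector g hg.continuous hs)
        (t⁻¹ • (translate t ψ - ψ))) (𝓝[≠] 0) (𝓝 (inner ℂ (testVector g hg.continuous hs) χ)) :=
      tendsto_const_nhds.inner H
    have h3 := tendsto_nhds_unique h1 (h2.congr fun t => by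
      rw [real_smul_eq, inner_smul_right, inner_sub_right, zero_add, translate_zero,
        Complex.real_smul])
    rw [inner_testVector] at h3
    simp only [sub_zero] at h3
    rw [← h3, neg_neg]
    
/-! ### The group generated by the momentum operator -/

theorem mem_momentumOp_graph {ħ : ℝ} (hħ : ħ ≠ 0) {ψ χ : OscSpace} :
    (ψ, χ) ∈ (momentumOp ħ).graph ↔ (ψ, (Complex.I / ħ) • χ) ∈ weakDerivGraph := by
  have hħ' : (ħ : ℂ) ≠ 0 := by exact_mod_cast hħ
  rw [← weakDeriv_graph, LinearPMap.mem_graph_iff, LinearPMap.mem_graph_iff]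
  constructor
  · rintro ⟨u, h1, h2⟩
    refine ⟨u, h1, ?_⟩
    have h3 : momentumOp ħ u = -(Complex.I * ħ) • weakDeriv u := rfl
    rw [h3] at h2
    simp only at h2 ⊢
    rw [← h2, smul_smul]
    have : Complex.I / ħ * -(Complex.I * ħ) = 1 := by
      field_simp
      rw [Complex.I_sq, neg_neg]
    rw [this, one_smul]
  · rintro ⟨u, h1, h2⟩
    refine ⟨u, h1, ?_⟩
    have h3 : momentumOp ħ u = -(Complex.I * ħ) • weakDeriv u := rfl
    simp only at h2
    rw [h3, h2, smul_smul]
    have : -(Complex.I * ħ) * (Complex.I / ħ) = 1 := by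
      field_simp
      rw [Complex.I_sq, neg_neg]
    rw [this, one_smul]

/-- The unitary group `e^{itP}`. -/
def momentumGroup (ħ : ℝ) : ℝ → unitary (OscSpace →L[ℂ] OscSpace) :=
  unitaryGroup (fun t => translate (ħ * t)) (fun ψ => by rw [mul_zero, translate_zero])
    (fun s t ψ => by rw [mul_add, translate_add])

theorem momentumGroup_apply (ħ t : ℝ) (ψ : OscSpace) :
    (momentumGroup ħ t : OscSpace →L[ℂ] OscSpace) ψ = translate (ħ * t) ψ := rfl

theorem isUnitaryGroupOf_momentumOp {ħ : ℝ} (hħ : ħ ≠ 0) :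
    IsUnitaryGroupOf (momentumOp ħ) (momentumGroup ħ) where
  add := unitaryGroup_add _ _ _
  continuous ψ := (continuous_translate ψ).comp (continuous_const_mul ħ)
  generator ψ χ := by
    have hħ' : (ħ : ℂ) ≠ 0 := by exact_mod_cast hħ
    rw [mem_momentumOp_graph hħ, mem_weakDerivGraph_iff_tendsto]
    -- The substitution `t ↦ ħt`, or its inverse, converts the difference quotient of `e^{itP}` into
    -- that of the translations.
    have key : ∀ {c : ℝ}, c ≠ 0 → Tendsto (fun t : ℝ => c * t) (𝓝[≠] 0) (𝓝[≠] 0) := by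
      intro c hc
      refine tendsto_nhdsWithin_iff.2 ⟨?_, ?_⟩
      · have : Tendsto (fun t : ℝ => c * t) (𝓝 0) (𝓝 (c * 0)) :=
          (continuous_const_mul c).tendsto 0
        rw [mul_zero] at this
        exact this.mono_left nhdsWithin_le_nhds
      · filter_upwards [self_mem_nhdsWithin] with t ht
        exact mul_ne_zero hc ht
    simp only [momentumGroup_apply]
    constructor
    · intro H
      have h1 := (H.comp (key hħ)).const_smul (ħ : ℂ)
      rw [smul_smul, mul_div_cancel₀ _ hħ'] at h1
      refine h1.congr fun t => ?_
      rw [Function.comp_apply, real_smul_eq, smul_smul]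
      congr 1
      push_cast
      field_simp
    · intro H
      have h1 := (H.comp (key (inv_ne_zero hħ))).const_smul (ħ : ℂ)⁻¹
      rw [smul_smul, inv_mul_eq_div] at h1
      refine h1.congr fun t => ?_
      rw [Function.comp_apply, real_smul_eq, smul_smul, mul_inv_cancel_left₀ hħ]
      congr 1
      push_cast
      field_simp

end


/-! ### Hermite functions and their ladder relations. -/

noncomputable section

open Polynomial

/-! ### Polynomials times a Gaussian -/

/-- The function `p(x) e^{-x²/2r²}`. -/
def gaussPoly (r : ℝ) (p : ℝ[X]) (x : ℝ) : ℝ := p.eval x * Real.exp (-(2 * r ^ 2)⁻¹ * x ^ 2)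

theorem continuous_gaussPoly (r : ℝ) (p : ℝ[X]) : Continuous (gaussPoly r p) := by
  unfold gaussPoly
  fun_prop

theorem memLp_gaussPoly {r : ℝ} (hr : 0 < r) (p : ℝ[X]) :
    MemLp (fun x => (gaussPoly r p x : ℂ)) 2 (volume : Measure ℝ) := by
  suffices h : MemLp (gaussPoly r p) 2 volume from h.ofReal
  induction p using Polynomial.induction_on' with
  | add p q hp hq =>
    refine (hp.add hq).ae_eq (Eventually.of_forall fun x => ?_)
    simp only [Pi.add_apply, gaussPoly, eval_add]
    ring
  | monomial n a =>
    rw [memLp_two_iff_integrable_sq (continuous_gaussPoly _ _).aestronglyMeasurable]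
    have h := (integrable_rpow_mul_exp_neg_mul_sq (b := (r ^ 2)⁻¹) (by positivity)
      (s := (2 * n : ℕ)) (by linarith [(Nat.cast_nonneg (2 * n) : (0 : ℝ) ≤ ((2 * n : ℕ) : ℝ))])).const_mul (a ^ 2)
    refine h.congr (Eventually.of_forall fun x => ?_)
    simp only [gaussPoly, eval_monomial, Real.rpow_natCast, mul_pow, ← Real.exp_nat_mul]
    rw [pow_mul' x 2 n]
    have : ((2 : ℕ) : ℝ) * (-(2 * r ^ 2)⁻¹ * x ^ 2) = -(r ^ 2)⁻¹ * x ^ 2 := by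
      push_cast
      field_simp
    rw [this]
    ring

/-- The element `p(x) e^{-x²/2r²}` of `L²`. -/
def gaussVector {r : ℝ} (hr : 0 < r) (p : ℝ[X]) : OscSpace := (memLp_gaussPoly hr p).toLp _

theorem coeFn_gaussVector {r : ℝ} (hr : 0 < r) (p : ℝ[X]) :
    gaussVector hr p =ᵐ[volume] fun x => (gaussPoly r p x : ℂ) :=
  (memLp_gaussPoly hr p).coeFn_toLp

theorem gaussVector_add {r : ℝ} (hr : 0 < r) (p q : ℝ[X]) :
    gaussVector hr (p + q) = gaussVector hr p + gaussVector hr q := by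
  apply Lp.ext
  filter_upwards [coeFn_gaussVector hr p, coeFn_gaussVector hr q, coeFn_gaussVector hr (p + q),
    Lp.coeFn_add (gaussVector hr p) (gaussVector hr q)] with x h1 h2 h3 h4
  rw [h3, h4, Pi.add_apply, h1, h2, gaussPoly, gaussPoly, gaussPoly, eval_add]
  push_cast
  ring

theorem gaussVector_smul {r : ℝ} (hr : 0 < r) (c : ℝ) (p : ℝ[X]) :
    gaussVector hr (c • p) = (c : ℂ) • gaussVector hr p := by
  apply Lp.ext
  filter_upwards [coeFn_gaussVector hr p, coeFn_gaussVector hr (c • p),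
    Lp.coeFn_smul (c : ℂ) (gaussVector hr p)] with x h1 h2 h3
  rw [h2, h3, Pi.smul_apply, h1, gaussPoly, gaussPoly, eval_smul, smul_eq_mul, smul_eq_mul]
  push_cast
  ring

theorem gaussVector_sub {r : ℝ} (hr : 0 < r) (p q : ℝ[X]) :
    gaussVector hr (p - q) = gaussVector hr p - gaussVector hr q := by
  have h : p - q = p + (-1 : ℝ) • q := by rw [neg_one_smul, sub_eq_add_neg]
  rw [h, gaussVector_add, gaussVector_smul]
  push_cast
  rw [neg_one_smul, sub_eq_add_neg]

theorem gaussVector_one_ne_zero {r : ℝ} (hr : 0 < r) : gaussVector hr 1 ≠ 0 := by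
  intro h
  have h1 := coeFn_gaussVector hr 1
  rw [h] at h1
  have h2 : (fun x => (gaussPoly r 1 x : ℂ)) =ᵐ[volume] fun _ => 0 :=
    h1.symm.trans (Lp.coeFn_zero ℂ 2 volume)
  have h3 := (Continuous.ae_eq_iff_eq volume
    (Complex.continuous_ofReal.comp (continuous_gaussPoly r 1)) continuous_const).1 h2
  have h4 := congrFun h3 0
  simp [gaussPoly] at h4

theorem gaussVector_mem_positionOp_graph {r : ℝ} (hr : 0 < r) (p : ℝ[X]) :
    (gaussVector hr p, gaussVector hr (X * p)) ∈ positionOp.graph := by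
  rw [mem_positionOp_graph]
  filter_upwards [coeFn_gaussVector hr p, coeFn_gaussVector hr (X * p)] with x h1 h2
  rw [h1, h2, gaussPoly, gaussPoly, eval_mul, eval_X]
  push_cast
  ring

theorem hasDerivAt_gaussPoly {r : ℝ} (hr : 0 < r) (p : ℝ[X]) (x : ℝ) :
    HasDerivAt (gaussPoly r p) (gaussPoly r (derivative p - (r ^ 2)⁻¹ • (X * p)) x) x := by
  have h1 := (p.hasDerivAt x).mul (((hasDerivAt_pow 2 x).const_mul (-(2 * r ^ 2)⁻¹)).exp)
  refine h1.congr_deriv ?_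
  simp only [gaussPoly, eval_sub, eval_smul, eval_mul, eval_X, smul_eq_mul]
  field_simp
  push_cast
  ring

theorem gaussVector_mem_weakDerivGraph {r : ℝ} (hr : 0 < r) (p : ℝ[X]) :
    (gaussVector hr p, gaussVector hr (derivative p - (r ^ 2)⁻¹ • (X * p))) ∈ weakDerivGraph := by
  intro g hg hs
  set q := derivative p - (r ^ 2)⁻¹ • (X * p)
  have h1 : ∀ (k : ℝ → ℝ) (s : ℝ[X]), ∫ x, k x • gaussVector hr s x =
      ((∫ x, k x * gaussPoly r s x : ℝ) : ℂ) := fun k s => by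
    rw [← integral_complex_ofReal]
    refine integral_congr_ae ?_
    filter_upwards [coeFn_gaussVector hr s] with x hx
    rw [hx, Complex.real_smul]
    push_cast
    rfl
  have hg' : Continuous (deriv g) := hg.continuous_deriv (by simp)
  change ∫ x, deriv g x • gaussVector hr p x = -∫ x, g x • gaussVector hr q x
  rw [h1, h1]
  have hc := continuous_gaussPoly r p
  have hc' := continuous_gaussPoly r q
  have h2 := integral_mul_deriv_eq_deriv_mul_of_integrable (u := g) (u' := deriv g)
    (v := gaussPoly r p) (v' := gaussPoly r q)
    (fun x _ => (hg.differentiable (by simp) x).hasDerivAt)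
    (fun x _ => hasDerivAt_gaussPoly hr p x)
    ((hg.continuous.mul hc').integrable_of_hasCompactSupport hs.mul_right)
    ((hg'.mul hc).integrable_of_hasCompactSupport hs.deriv.mul_right)
    ((hg.continuous.mul hc).integrable_of_hasCompactSupport hs.mul_right)
  rw [h2]
  push_cast
  rw [neg_neg]

theorem gaussVector_mem_momentumOp_graph {ħ r : ℝ} (hħ : ħ ≠ 0) (hr : 0 < r) (p : ℝ[X]) :
    (gaussVector hr p, (-(Complex.I * ħ)) •
      gaussVector hr (derivative p - (r ^ 2)⁻¹ • (X * p))) ∈ (momentumOp ħ).graph := by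
  have hħ' : (ħ : ℂ) ≠ 0 := by exact_mod_cast hħ
  rw [mem_momentumOp_graph hħ, smul_smul]
  have : Complex.I / ħ * -(Complex.I * ħ) = 1 := by
    field_simp
    rw [Complex.I_sq, neg_neg]
  rw [this, one_smul]
  exact gaussVector_mem_weakDerivGraph hr p

/-! ### Annihilation and creation -/

/-- `(ξ + i (r² / ħ) π) / (√2 r)`: the annihilation operator at a vector with position image `ξ`
and momentum image `π`. -/
def annihilate (ħ r : ℝ) (ξ π : OscSpace) : OscSpace :=
  (((√2 * r : ℝ) : ℂ)⁻¹) • (ξ + (Complex.I * ((r ^ 2 / ħ : ℝ) : ℂ)) • π)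

/-- `(ξ - i (r² / ħ) π) / (√2 r)`: the creation operator at a vector with position image `ξ`
and momentum image `π`. -/
def create (ħ r : ℝ) (ξ π : OscSpace) : OscSpace :=
  (((√2 * r : ℝ) : ℂ)⁻¹) • (ξ - (Complex.I * ((r ^ 2 / ħ : ℝ) : ℂ)) • π)

theorem mem_annihilationOp_graph {ħ r : ℝ} {ψ χ : OscSpace} :
    (ψ, χ) ∈ (annihilationOp ħ r).graph ↔ ∃ ξ π, (ψ, ξ) ∈ positionOp.graph ∧
      (ψ, π) ∈ (momentumOp ħ).graph ∧ χ = annihilate ħ r ξ π := by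
  constructor
  · intro h
    obtain ⟨u, rfl, rfl⟩ := (LinearPMap.mem_graph_iff _).1 h
    have h1 : (u : OscSpace) ∈ positionOp.domain := u.2.1
    have h2 : (u : OscSpace) ∈ (momentumOp ħ).domain := u.2.2
    exact ⟨positionOp ⟨u, h1⟩, momentumOp ħ ⟨u, h2⟩, positionOp.mem_graph ⟨u, h1⟩,
      (momentumOp ħ).mem_graph ⟨u, h2⟩, rfl⟩
  · rintro ⟨ξ, π, h1, h2, rfl⟩
    obtain ⟨u, hu, rfl⟩ := (LinearPMap.mem_graph_iff _).1 h1
    obtain ⟨v, hv, rfl⟩ := (LinearPMap.mem_graph_iff _).1 h2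
    simp only at hu hv
    have hd : ψ ∈ (annihilationOp ħ r).domain := ⟨hu ▸ u.2, hv ▸ v.2⟩
    refine (LinearPMap.mem_graph_iff _).2 ⟨⟨ψ, hd⟩, rfl, ?_⟩
    subst hu
    have hv' : v = ⟨u, hd.2⟩ := Subtype.ext hv
    rw [hv']
    rfl

/-- Creation is formally adjoint to annihilation. -/
theorem inner_create {ħ r : ℝ} (hħ : ħ ≠ 0) {ψ ξ π ψ' ξ' π' : OscSpace}
    (hξ : (ψ, ξ) ∈ positionOp.graph) (hπ : (ψ, π) ∈ (momentumOp ħ).graph)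
    (hξ' : (ψ', ξ') ∈ positionOp.graph) (hπ' : (ψ', π') ∈ (momentumOp ħ).graph) :
    inner ℂ (create ħ r ξ π) ψ' = inner ℂ ψ (annihilate ħ r ξ' π') := by
  simp only [create, annihilate, inner_smul_left, inner_smul_right, inner_add_right,
    inner_sub_left, map_inv₀, map_mul, Complex.conj_ofReal, Complex.conj_I,
    isUnitaryGroupOf_positionOp.inner_symm hξ hξ',
    (isUnitaryGroupOf_momentumOp hħ).inner_symm hπ hπ']
  ring

/-! ### Hermite polynomials -/

/-- Annihilation on polynomials. -/
def lowerPoly (r : ℝ) (p : ℝ[X]) : ℝ[X] := (r / √2) • derivative p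

/-- Creation on polynomials. -/
def raisePoly (r : ℝ) (p : ℝ[X]) : ℝ[X] := (√2 / r) • (X * p) - (r / √2) • derivative p

theorem annihilate_gaussVector {ħ r : ℝ} (hħ : ħ ≠ 0) (hr : 0 < r) (p : ℝ[X]) :
    annihilate ħ r (gaussVector hr (X * p)) ((-(Complex.I * ħ)) •
      gaussVector hr (derivative p - (r ^ 2)⁻¹ • (X * p))) = gaussVector hr (lowerPoly r p) := by
  have hħ' : (ħ : ℂ) ≠ 0 := by exact_mod_cast hħ
  have hr' : (r : ℂ) ≠ 0 := by exact_mod_cast hr.ne'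
  have h2 : ((√2 : ℝ) : ℂ) ≠ 0 := by simp
  rw [annihilate, lowerPoly, gaussVector_smul, gaussVector_sub, gaussVector_smul, smul_smul]
  have h3 : Complex.I * ((r ^ 2 / ħ : ℝ) : ℂ) * -(Complex.I * ħ) = (r : ℂ) ^ 2 := by
    push_cast
    field_simp
    rw [Complex.I_sq, neg_neg]
  rw [h3]
  match_scalars <;> field_simp
  ring

theorem create_gaussVector {ħ r : ℝ} (hħ : ħ ≠ 0) (hr : 0 < r) (p : ℝ[X]) :
    create ħ r (gaussVector hr (X * p)) ((-(Complex.I * ħ)) •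
      gaussVector hr (derivative p - (r ^ 2)⁻¹ • (X * p))) = gaussVector hr (raisePoly r p) := by
  have hħ' : (ħ : ℂ) ≠ 0 := by exact_mod_cast hħ
  have hr' : (r : ℂ) ≠ 0 := by exact_mod_cast hr.ne'
  have h2 : ((√2 : ℝ) : ℂ) ≠ 0 := by simp
  have h22 : ((√2 : ℝ) : ℂ) ^ 2 = 2 := by
    rw [← Complex.ofReal_pow, Real.sq_sqrt (by norm_num)]
    norm_num
  rw [create, raisePoly]
  simp only [gaussVector_sub, gaussVector_smul]
  rw [smul_smul]
  have h3 : Complex.I * ((r ^ 2 / ħ : ℝ) : ℂ) * -(Complex.I * ħ) = (r : ℂ) ^ 2 := by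
    push_cast
    field_simp
    rw [Complex.I_sq, neg_neg]
  rw [h3]
  match_scalars
  · field_simp
    rw [h22]
    ring
  · field_simp

theorem gaussVector_mem_annihilationOp_graph {ħ r : ℝ} (hħ : ħ ≠ 0) (hr : 0 < r) (p : ℝ[X]) :
    (gaussVector hr p, gaussVector hr (lowerPoly r p)) ∈ (annihilationOp ħ r).graph :=
  mem_annihilationOp_graph.2 ⟨_, _, gaussVector_mem_positionOp_graph hr p,
    gaussVector_mem_momentumOp_graph hħ hr p, (annihilate_gaussVector hħ hr p).symm⟩

/-- Here `ψ` is any vector of `dom a`, not only a polynomial times a Gaussian; this is what later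
reads off the Hermite coefficients of `aψ`. -/
theorem inner_gaussVector_raisePoly {ħ r : ℝ} (hħ : ħ ≠ 0) (hr : 0 < r) (p : ℝ[X])
    {ψ χ : OscSpace} (h : (ψ, χ) ∈ (annihilationOp ħ r).graph) :
    inner ℂ (gaussVector hr (raisePoly r p)) ψ = inner ℂ (gaussVector hr p) χ := by
  obtain ⟨ξ, π, h1, h2, rfl⟩ := mem_annihilationOp_graph.1 h
  rw [← create_gaussVector hħ hr]
  exact inner_create hħ (gaussVector_mem_positionOp_graph hr p)
    (gaussVector_mem_momentumOp_graph hħ hr p) h1 h2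

/-- Unnormalised Hermite polynomials adapted to the Gaussian `e^{-x²/2r²}`. -/
def hermitePoly (r : ℝ) : ℕ → ℝ[X]
  | 0 => 1
  | n + 1 => raisePoly r (hermitePoly r n)

/-- The canonical commutation relation `a a† = 1 + a† a`, on polynomials. -/
theorem lowerPoly_raisePoly {r : ℝ} (hr : 0 < r) (p : ℝ[X]) :
    lowerPoly r (raisePoly r p) = p + raisePoly r (lowerPoly r p) := by
  have h1 : r / √2 * (√2 / r) = 1 := by
    have : √2 ≠ 0 := by simp
    field_simp
  simp only [lowerPoly, raisePoly, derivative_sub, derivative_smul, derivative_mul, derivative_X,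
    one_mul, smul_sub, smul_add, smul_smul, mul_smul_comm, h1, one_smul, mul_comm (√2 / r)]
  abel

theorem lowerPoly_hermitePoly {r : ℝ} (hr : 0 < r) (n : ℕ) :
    lowerPoly r (hermitePoly r (n + 1)) = ((n : ℝ) + 1) • hermitePoly r n := by
  induction n with
  | zero =>
    change lowerPoly r (raisePoly r 1) = _
    rw [lowerPoly_raisePoly hr]
    simp [hermitePoly, lowerPoly, raisePoly]
  | succ n ih =>
    rw [hermitePoly, lowerPoly_raisePoly hr, ih]
    have : raisePoly r (((n : ℝ) + 1) • hermitePoly r n) =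
        ((n : ℝ) + 1) • hermitePoly r (n + 1) := by
      rw [hermitePoly]
      simp only [raisePoly, derivative_smul, mul_smul_comm, smul_sub, smul_comm ((n : ℝ) + 1)]
    rw [this]
    push_cast
    module

/-- Induction on `m`: one creation operator is moved across the inner product, where it lowers the
other Hermite polynomial and produces the factor of the factorial. -/
theorem inner_hermite {r : ℝ} (hr : 0 < r) (m n : ℕ) :
    inner ℂ (gaussVector hr (hermitePoly r m)) (gaussVector hr (hermitePoly r n)) =
      if m = n then ((n.factorial * ‖gaussVector hr 1‖ ^ 2 : ℝ) : ℂ) else 0 := by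
  -- The vectors and polynomials do not involve `ħ`, so the adjoint relation may be used with `ħ =
  -- 1`.
  have key : ∀ p q, inner ℂ (gaussVector hr (raisePoly r p)) (gaussVector hr q) =
      inner ℂ (gaussVector hr p) (gaussVector hr (lowerPoly r q)) := fun p q =>
    inner_gaussVector_raisePoly one_ne_zero hr p
      (gaussVector_mem_annihilationOp_graph one_ne_zero hr q)
  have h0 : gaussVector hr (lowerPoly r (hermitePoly r 0)) = 0 := by
    have : lowerPoly r (hermitePoly r 0) = (0 : ℝ) • (1 : ℝ[X]) := by
      simp [lowerPoly, hermitePoly]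
    rw [this, gaussVector_smul]
    simp
  induction m generalizing n with
  | zero =>
    cases n with
    | zero =>
      rw [inner_self_eq_norm_sq_to_K]
      simp [hermitePoly]
    | succ n =>
      rw [← inner_conj_symm]
      change conj (inner ℂ (gaussVector hr (raisePoly r (hermitePoly r n))) _) = _
      rw [key, h0]
      simp
  | succ m ih =>
    change inner ℂ (gaussVector hr (raisePoly r (hermitePoly r m))) _ = _
    rw [key]
    cases n with
    | zero => simp [h0]
    | succ n =>
      rw [lowerPoly_hermitePoly hr, gaussVector_smul, inner_smul_right, ih]
      simp only [Nat.add_right_cancel_iff]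
      split_ifs with h
      · rw [Nat.factorial_succ]
        push_cast
        ring
      · rw [mul_zero]

/-- The normalising factor of the `n`-th Hermite function. -/
def hermiteNorm {r : ℝ} (hr : 0 < r) (n : ℕ) : ℝ := √(n.factorial) * ‖gaussVector hr 1‖

theorem hermiteNorm_pos {r : ℝ} (hr : 0 < r) (n : ℕ) : 0 < hermiteNorm hr n :=
  mul_pos (Real.sqrt_pos.2 (by exact_mod_cast n.factorial_pos))
    (norm_pos_iff.2 (gaussVector_one_ne_zero hr))

theorem hermiteNorm_succ {r : ℝ} (hr : 0 < r) (n : ℕ) :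
    hermiteNorm hr (n + 1) = √(n + 1) * hermiteNorm hr n := by
  rw [hermiteNorm, hermiteNorm, Nat.factorial_succ]
  push_cast
  rw [Real.sqrt_mul (by positivity), mul_assoc]

/-- The normalised Hermite functions. -/
def hermiteVector {r : ℝ} (hr : 0 < r) (n : ℕ) : OscSpace :=
  ((hermiteNorm hr n)⁻¹ : ℂ) • gaussVector hr (hermitePoly r n)

theorem orthonormal_hermiteVector {r : ℝ} (hr : 0 < r) :
    Orthonormal ℂ (hermiteVector hr) := by
  rw [orthonormal_iff_ite]
  intro m n
  rw [hermiteVector, hermiteVector, inner_smul_left, inner_smul_right, inner_hermite]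
  split_ifs with h
  · subst h
    have h1 := (hermiteNorm_pos hr m).ne'
    have h2 : (m.factorial : ℝ) * ‖gaussVector hr 1‖ ^ 2 = hermiteNorm hr m ^ 2 := by
      rw [hermiteNorm, mul_pow, Real.sq_sqrt (by positivity)]
    have h3 : (hermiteNorm hr m : ℂ) ≠ 0 := by exact_mod_cast h1
    rw [h2, map_inv₀, Complex.conj_ofReal]
    push_cast
    field_simp
  · simp

end


/-! ### Completeness of the Hermite functions and the exact domain of the annihilation operator. -/

noncomputable section

open Polynomial
open scoped FourierTransform SchwartzMap

/-! ### Completeness of the Hermite functions -/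

/-- An integrable function with vanishing Fourier transform vanishes. -/
theorem ae_eq_zero_of_fourier_eq_zero {F : ℝ → ℂ} (hF : Integrable F)
    (h : ∀ w : ℝ, ∫ x, Complex.exp ((w * x : ℝ) * Complex.I) * F x = 0) : ∀ᵐ x, F x = 0 := by
  have h0 : ∀ w, 𝓕 F w = 0 := fun w => by
    -- The kernel of `𝓕` is `e^{-2πiwx}`, so the hypothesis is used at frequency `-2πw`.
    rw [Real.fourier_real_eq_integral_exp_smul, ← h (-2 * Real.pi * w)]
    refine integral_congr_ae (Eventually.of_forall fun x => ?_)
    simp only [smul_eq_mul]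
    congr 3
    push_cast
    ring
  refine ae_eq_zero_of_integral_contDiff_smul_eq_zero hF.locallyIntegrable fun g hg hs => ?_
  have hs' : HasCompactSupport fun x => (g x : ℂ) := hs.comp_left Complex.ofReal_zero
  have hg' : ContDiff ℝ ∞ fun x => (g x : ℂ) := Complex.ofRealCLM.contDiff.comp hg
  set G : 𝓢(ℝ, ℂ) := hs'.toSchwartzMap hg' with hG
  -- Each test function is the Fourier transform of a Schwartz function, and `𝓕` can be moved across
  -- the integral onto `F`.
  obtain ⟨H, hH⟩ : ∃ H : 𝓢(ℝ, ℂ), 𝓕 H = G := ⟨𝓕⁻ G, FourierTransform.fourier_fourierInv_eq G⟩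
  have h1 : ∫ w, 𝓕 F w • H w = ∫ x, F x • (𝓕 H) x := by
    simpa using! VectorFourier.integral_fourierIntegral_smul_eq_flip (L := innerₗ ℝ)
      Real.continuous_fourierChar continuous_inner hF (H.integrable (μ := volume))
  rw [hH] at h1
  simp only [h0, zero_smul, integral_zero] at h1
  rw [h1]
  refine integral_congr_ae (Eventually.of_forall fun x => ?_)
  simp [hG, mul_comm]

theorem inner_gaussVector {r : ℝ} (hr : 0 < r) (p : ℝ[X]) (ψ : OscSpace) :
    inner ℂ (gaussVector hr p) ψ = ∫ x, (gaussPoly r p x : ℂ) * ψ x := by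
  rw [L2.inner_def]
  refine integral_congr_ae ?_
  filter_upwards [coeFn_gaussVector hr p] with x hx
  rw [RCLike.inner_apply, hx, Complex.conj_ofReal, mul_comm]

theorem integrable_gaussPoly_mul {r : ℝ} (hr : 0 < r) (p : ℝ[X]) (ψ : OscSpace) :
    Integrable fun x => (gaussPoly r p x : ℂ) * ψ x :=
  (memLp_gaussPoly hr p).integrable_mul (Lp.memLp ψ)

/-- From `|wx| ≤ w²r² + x²/4r²`: half of the Gaussian exponent absorbs `e^{|wx|}`. What is left is a
Gaussian of width `√2 r`, still in `L²`, so its product with `ψ` is integrable. -/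
theorem exp_abs_mul_gaussPoly_le {r : ℝ} (hr : 0 < r) (w x : ℝ) :
    Real.exp |w * x| * gaussPoly r 1 x ≤
      Real.exp (w ^ 2 * r ^ 2) * gaussPoly (√2 * r) 1 x := by
  have h2 : (√2 * r) ^ 2 = 2 * r ^ 2 := by rw [mul_pow, Real.sq_sqrt (by norm_num)]
  simp only [gaussPoly, eval_one, one_mul, h2, ← Real.exp_add]
  rw [Real.exp_le_exp]
  have h3 : -(2 * r ^ 2)⁻¹ * x ^ 2 = -2 * (x / (2 * r)) ^ 2 := by
    field_simp
  have h4 : -(2 * (2 * r ^ 2))⁻¹ * x ^ 2 = -(x / (2 * r)) ^ 2 := by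
    field_simp
  have h5 : |w * x| = 2 * (|w * r| * |x / (2 * r)|) := by
    rw [← abs_mul]
    have : w * x = 2 * (w * r * (x / (2 * r))) := by field_simp
    rw [this, abs_mul, abs_two]
  rw [h3, h4, h5, ← mul_pow, ← sq_abs (w * r), ← sq_abs (x / (2 * r))]
  nlinarith [sq_nonneg (|w * r| - |x / (2 * r)|)]

theorem hasSum_real_exp (y : ℝ) : HasSum (fun n : ℕ => y ^ n / n.factorial) (Real.exp y) := by
  rw [Real.exp_eq_exp_ℝ]
  exact NormedSpace.expSeries_div_hasSum_exp y

theorem hasSum_complex_exp (z : ℂ) :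
    HasSum (fun n : ℕ => z ^ n / n.factorial) (Complex.exp z) := by
  rw [Complex.exp_eq_exp_ℂ]
  exact NormedSpace.expSeries_div_hasSum_exp z

/-- Expanding `e^{iwx}` in its power series leaves moments of `ψ` against `xⁿ e^{-x²/2r²}`, all
zero. Summation and integration commute because `e^{|wx|}` times the Gaussian times `|ψ|` is
integrable. -/
theorem integral_exp_mul_eq_zero {r : ℝ} (hr : 0 < r) {ψ : OscSpace}
    (h : ∀ p, inner ℂ (gaussVector hr p) ψ = 0) (w : ℝ) :
    ∫ x, Complex.exp ((w * x : ℝ) * Complex.I) * ((gaussPoly r 1 x : ℂ) * ψ x) = 0 := by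
  have hm := (integrable_gaussPoly_mul hr 1 ψ).1
  have hpos : ∀ s x, 0 < gaussPoly s 1 x := fun s x => by simp [gaussPoly, Real.exp_pos]
  have hreal : ∀ x : ℝ, HasSum (fun n : ℕ => |w * x| ^ n / n.factorial *
      ‖(gaussPoly r 1 x : ℂ) * ψ x‖) (Real.exp |w * x| * ‖(gaussPoly r 1 x : ℂ) * ψ x‖) :=
    fun x => (hasSum_real_exp _).mul_right _
  have hs := hasSum_integral_of_dominated_convergence (μ := (volume : Measure ℝ))
    (F := fun (n : ℕ) x => ((w * x : ℝ) * Complex.I) ^ n / n.factorial *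
      ((gaussPoly r 1 x : ℂ) * ψ x))
    (f := fun x => Complex.exp ((w * x : ℝ) * Complex.I) * ((gaussPoly r 1 x : ℂ) * ψ x))
    (fun n x => |w * x| ^ n / n.factorial * ‖(gaussPoly r 1 x : ℂ) * ψ x‖)
    (fun n => (Continuous.aestronglyMeasurable (by fun_prop)).mul hm)
    (fun n => Eventually.of_forall fun x => le_of_eq (by
      rw [norm_mul, norm_div, norm_pow, norm_mul, Complex.norm_real, Complex.norm_I, mul_one,
        Real.norm_eq_abs, Complex.norm_natCast]))
    (Eventually.of_forall fun x => (hreal x).summable)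
    (by
      simp only [fun x => (hreal x).tsum_eq]
      refine (((integrable_gaussPoly_mul (r := √2 * r) (by positivity) 1 ψ).norm).const_mul
        (Real.exp (w ^ 2 * r ^ 2))).mono'
        ((Continuous.aestronglyMeasurable (by fun_prop)).mul hm.norm)
        (Eventually.of_forall fun x => ?_)
      rw [Real.norm_of_nonneg (by positivity), norm_mul, norm_mul, Complex.norm_real,
        Complex.norm_real, Real.norm_of_nonneg (hpos _ _).le, Real.norm_of_nonneg (hpos _ _).le,
        ← mul_assoc, ← mul_assoc]
      exact mul_le_mul_of_nonneg_right (exp_abs_mul_gaussPoly_le hr w x) (norm_nonneg _))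
    (Eventually.of_forall fun x => (hasSum_complex_exp _).mul_right _)
  have hz : ∀ n : ℕ, ∫ x, ((w * x : ℝ) * Complex.I) ^ n / n.factorial *
      ((gaussPoly r 1 x : ℂ) * ψ x) = 0 := fun n => by
    have h1 := h (X ^ n)
    rw [inner_gaussVector] at h1
    have h2 : ∀ x : ℝ, ((w * x : ℝ) * Complex.I) ^ n / n.factorial *
        ((gaussPoly r 1 x : ℂ) * ψ x) = ((w * Complex.I) ^ n / n.factorial) *
        ((gaussPoly r (X ^ n) x : ℂ) * ψ x) := fun x => by
      simp only [gaussPoly, eval_one, eval_pow, eval_X]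
      push_cast
      ring
    simp only [h2]
    rw [integral_const_mul, h1, mul_zero]
  simp only [hz] at hs
  exact hs.unique hasSum_zero

theorem eq_zero_of_inner_gaussVector {r : ℝ} (hr : 0 < r) {ψ : OscSpace}
    (h : ∀ p, inner ℂ (gaussVector hr p) ψ = 0) : ψ = 0 := by
  refine (Lp.eq_zero_iff_ae_eq_zero).2 ?_
  filter_upwards [ae_eq_zero_of_fourier_eq_zero (integrable_gaussPoly_mul hr 1 ψ)
    (integral_exp_mul_eq_zero hr h)] with x hx
  have hne : (gaussPoly r 1 x : ℂ) ≠ 0 := by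
    simp [gaussPoly]
  exact (mul_eq_zero.1 hx).resolve_left hne

/-- Since `√2/r · X = a + a†` on polynomials, the span is stable under multiplication by `X`; it
also contains `1`. -/
theorem span_hermitePoly {r : ℝ} (hr : 0 < r) :
    Submodule.span ℝ (Set.range (hermitePoly r)) = ⊤ := by
  set S := Submodule.span ℝ (Set.range (hermitePoly r))
  have hmem : ∀ n, hermitePoly r n ∈ S := fun n => Submodule.subset_span ⟨n, rfl⟩
  have hX : ∀ p ∈ S, X * p ∈ S := by
    intro p hp
    induction hp using Submodule.span_induction with
    | mem p hp =>
      obtain ⟨n, rfl⟩ := hp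
      have h1 : X * hermitePoly r n = (r / √2) • (lowerPoly r (hermitePoly r n) +
          hermitePoly r (n + 1)) := by
        have h2 : r / √2 * (√2 / r) = 1 := by
          have : √2 ≠ 0 := by simp
          field_simp
        rw [hermitePoly, lowerPoly, raisePoly, add_sub_cancel, smul_smul, h2, one_smul]
      rw [h1]
      refine S.smul_mem _ (S.add_mem ?_ (hmem _))
      cases n with
      | zero => simp [lowerPoly, hermitePoly]
      | succ n =>
        rw [lowerPoly_hermitePoly hr]
        exact S.smul_mem _ (hmem n)
    | zero => simp
    | add p q _ _ hp hq =>
      rw [mul_add]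
      exact S.add_mem hp hq
    | smul c p _ hp =>
      rw [mul_smul_comm]
      exact S.smul_mem c hp
  have hpow : ∀ n : ℕ, (X : ℝ[X]) ^ n ∈ S := by
    intro n
    induction n with
    | zero => simpa [hermitePoly] using hmem 0
    | succ n ih =>
      rw [pow_succ']
      exact hX _ ih
  rw [eq_top_iff]
  rintro p -
  induction p using Polynomial.induction_on' with
  | add p q hp hq => exact S.add_mem hp hq
  | monomial n a =>
    rw [← C_mul_X_pow_eq_monomial, ← smul_eq_C_mul]
    exact S.smul_mem a (hpow n)

/-- The Hilbert basis of Hermite functions. -/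
def hermiteBasis {r : ℝ} (hr : 0 < r) : HilbertBasis ℕ ℂ OscSpace :=
  HilbertBasis.mkOfOrthogonalEqBot (orthonormal_hermiteVector hr) (by
    rw [Submodule.eq_bot_iff]
    intro ψ hψ
    rw [Submodule.mem_orthogonal] at hψ
    have h1 : ∀ n, inner ℂ (gaussVector hr (hermitePoly r n)) ψ = 0 := fun n => by
      have h2 := hψ _ (Submodule.subset_span ⟨n, rfl⟩)
      rw [hermiteVector, inner_smul_left, map_inv₀, Complex.conj_ofReal] at h2
      refine (mul_eq_zero.1 h2).resolve_left (inv_ne_zero ?_)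
      exact_mod_cast (hermiteNorm_pos hr n).ne'
    refine eq_zero_of_inner_gaussVector hr fun p => ?_
    have hp : p ∈ Submodule.span ℝ (Set.range (hermitePoly r)) := by
      rw [span_hermitePoly hr]
      trivial
    induction hp using Submodule.span_induction with
    | mem p hp =>
      obtain ⟨n, rfl⟩ := hp
      exact h1 n
    | zero =>
      have : (0 : ℝ[X]) = (0 : ℝ) • (1 : ℝ[X]) := by simp
      rw [this, gaussVector_smul]
      simp
    | add p q _ _ hp hq => rw [gaussVector_add, inner_add_left, hp, hq, add_zero]
    | smul c p _ hp => rw [gaussVector_smul, inner_smul_left, hp, mul_zero])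

theorem hermiteBasis_apply {r : ℝ} (hr : 0 < r) (n : ℕ) :
    hermiteBasis hr n = hermiteVector hr n := by
  rw [hermiteBasis, HilbertBasis.coe_mkOfOrthogonalEqBot]

/-! ### The annihilation operator in the Hermite basis -/

theorem inner_hermiteBasis_of_mem_graph {ħ r : ℝ} (hħ : ħ ≠ 0) (hr : 0 < r) {ψ χ : OscSpace}
    (h : (ψ, χ) ∈ (annihilationOp ħ r).graph) (n : ℕ) :
    inner ℂ (hermiteBasis hr n) χ = (√(n + 1) : ℝ) * inner ℂ (hermiteBasis hr (n + 1)) ψ := by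
  rw [hermiteBasis_apply, hermiteBasis_apply, hermiteVector, hermiteVector, inner_smul_left,
    inner_smul_left, ← inner_gaussVector_raisePoly hħ hr _ h, map_inv₀, map_inv₀,
    Complex.conj_ofReal, Complex.conj_ofReal, hermiteNorm_succ, hermitePoly]
  have h1 : (hermiteNorm hr n : ℂ) ≠ 0 := by exact_mod_cast (hermiteNorm_pos hr n).ne'
  have h2 : ((√(n + 1) : ℝ) : ℂ) ≠ 0 := by
    have : (0 : ℝ) < √(n + 1) := Real.sqrt_pos.2 (by positivity)
    exact_mod_cast this.ne'
  push_cast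
  field_simp

theorem positionOp_graph_closed {ψ : ℕ → OscSpace} {ξ : ℕ → OscSpace} {ψ₀ ξ₀ : OscSpace}
    (h : ∀ k, (ψ k, ξ k) ∈ positionOp.graph) (hψ : Tendsto ψ atTop (𝓝 ψ₀))
    (hξ : Tendsto ξ atTop (𝓝 ξ₀)) : (ψ₀, ξ₀) ∈ positionOp.graph := by
  obtain ⟨ns, h1, h2⟩ := (tendstoInMeasure_of_tendsto_Lp hψ).exists_seq_tendsto_ae'
  rw [mem_positionOp_graph]
  refine ae_eq_of_tendsto (fun k => mem_positionOp_graph.1 (h (ns k))) (hξ.comp h1) ?_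
  filter_upwards [h2] with x hx
  exact hx.const_mul _

theorem momentumOp_graph_closed {ħ : ℝ} (hħ : ħ ≠ 0) {ψ : ℕ → OscSpace} {π : ℕ → OscSpace}
    {ψ₀ π₀ : OscSpace} (h : ∀ k, (ψ k, π k) ∈ (momentumOp ħ).graph)
    (hψ : Tendsto ψ atTop (𝓝 ψ₀)) (hπ : Tendsto π atTop (𝓝 π₀)) :
    (ψ₀, π₀) ∈ (momentumOp ħ).graph := by
  simp only [mem_momentumOp_graph hħ] at h ⊢
  intro g hg hs
  have hg' : Continuous (deriv g) := hg.continuous_deriv (by simp)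
  have h1 : ∀ k, inner ℂ (testVector (deriv g) hg' hs.deriv) (ψ k) =
      -inner ℂ (testVector g hg.continuous hs) ((Complex.I / ħ) • π k) := fun k => by
    rw [inner_testVector, inner_testVector]
    exact h k g hg hs
  change ∫ x, deriv g x • ψ₀ x = -∫ x, g x • ((Complex.I / ħ) • π₀ : OscSpace) x
  rw [← inner_testVector hg' hs.deriv, ← inner_testVector hg.continuous hs]
  have h2 : Tendsto (fun k => inner ℂ (testVector (deriv g) hg' hs.deriv) (ψ k)) atTop
      (𝓝 (inner ℂ (testVector (deriv g) hg' hs.deriv) ψ₀)) := tendsto_const_nhds.inner hψ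
  refine tendsto_nhds_unique h2 ?_
  simp only [h1]
  exact (tendsto_const_nhds.inner (hπ.const_smul _)).neg

/-- With its counterpart for momentum, this turns convergence of `a u_k` and `a† u_k` into
convergence of `Q u_k` and `P u_k`. -/
theorem position_eq_annihilate_add_create {ħ r : ℝ} (hr : 0 < r) (ξ π : OscSpace) :
    ξ = ((r / √2 : ℝ) : ℂ) • (annihilate ħ r ξ π + create ħ r ξ π) := by
  have hr' : (r : ℂ) ≠ 0 := by exact_mod_cast hr.ne'
  have h2 : ((√2 : ℝ) : ℂ) ≠ 0 := by simp
  have h22 : ((√2 : ℝ) : ℂ) ^ 2 = 2 := by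
    rw [← Complex.ofReal_pow, Real.sq_sqrt (by norm_num)]
    norm_num
  rw [annihilate, create]
  match_scalars
  · field_simp
    rw [h22]
    ring
  · ring

theorem momentum_eq_annihilate_sub_create {ħ r : ℝ} (hħ : ħ ≠ 0) (hr : 0 < r)
    (ξ π : OscSpace) :
    π = (-(Complex.I * ((ħ / (√2 * r) : ℝ) : ℂ))) •
      (annihilate ħ r ξ π - create ħ r ξ π) := by
  have hħ' : (ħ : ℂ) ≠ 0 := by exact_mod_cast hħ
  have hr' : (r : ℂ) ≠ 0 := by exact_mod_cast hr.ne'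
  have h2 : ((√2 : ℝ) : ℂ) ≠ 0 := by simp
  have h22 : ((√2 : ℝ) : ℂ) ^ 2 = 2 := by
    rw [← Complex.ofReal_pow, Real.sq_sqrt (by norm_num)]
    norm_num
  rw [annihilate, create]
  match_scalars
  · field_simp
    rw [h22, Complex.I_sq]
    ring
  · ring

theorem hermiteBasis_mem_positionOp_domain {r : ℝ} (hr : 0 < r) (n : ℕ) :
    hermiteBasis hr n ∈ positionOp.domain := by
  rw [hermiteBasis_apply]
  exact positionOp.domain.smul_mem _
    (LinearPMap.mem_domain_of_mem_graph (gaussVector_mem_positionOp_graph hr _))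

theorem hermiteBasis_mem_momentumOp_domain {ħ r : ℝ} (hħ : ħ ≠ 0) (hr : 0 < r) (n : ℕ) :
    hermiteBasis hr n ∈ (momentumOp ħ).domain := by
  rw [hermiteBasis_apply]
  exact (momentumOp ħ).domain.smul_mem _
    (LinearPMap.mem_domain_of_mem_graph (gaussVector_mem_momentumOp_graph hħ hr _))

/-- Formal adjointness moves creation onto `b n`, whose image under `a` is already determined by its
coefficients. The graph of `a†` does not enter. -/
theorem inner_hermiteBasis_create {ħ r : ℝ} (hħ : ħ ≠ 0) (hr : 0 < r) {ψ ξ π : OscSpace}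
    (hξ : (ψ, ξ) ∈ positionOp.graph) (hπ : (ψ, π) ∈ (momentumOp ħ).graph) :
    inner ℂ (hermiteBasis hr 0) (create ħ r ξ π) = 0 ∧ ∀ n : ℕ,
      inner ℂ (hermiteBasis hr (n + 1)) (create ħ r ξ π) =
        (√(n + 1) : ℝ) * inner ℂ (hermiteBasis hr n) ψ := by
  have key : ∀ n χ, (hermiteBasis hr n, χ) ∈ (annihilationOp ħ r).graph →
      inner ℂ (hermiteBasis hr n) (create ħ r ξ π) = inner ℂ χ ψ := by
    intro n χ h
    obtain ⟨ξ', π', h1, h2, rfl⟩ := mem_annihilationOp_graph.1 h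
    rw [← inner_conj_symm, inner_create hħ hξ hπ h1 h2, inner_conj_symm]
  have hg : ∀ n, ∃ χ, (hermiteBasis hr n, χ) ∈ (annihilationOp ħ r).graph := fun n =>
    LinearPMap.mem_domain_iff.1 ⟨hermiteBasis_mem_positionOp_domain hr n,
      hermiteBasis_mem_momentumOp_domain hħ hr n⟩
  constructor
  · obtain ⟨χ, hχ⟩ := hg 0
    have h0 : χ = 0 := hilbertBasis_ext (hermiteBasis hr) fun n => by
      rw [inner_hermiteBasis_of_mem_graph hħ hr hχ,
        orthonormal_iff_ite.1 (hermiteBasis hr).orthonormal]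
      simp
    rw [key 0 χ hχ, h0, inner_zero_left]
  · intro n
    obtain ⟨χ, hχ⟩ := hg (n + 1)
    have h0 : χ = ((√(n + 1) : ℝ) : ℂ) • hermiteBasis hr n :=
      hilbertBasis_ext (hermiteBasis hr) fun k => by
        rw [inner_hermiteBasis_of_mem_graph hħ hr hχ, inner_smul_right,
          orthonormal_iff_ite.1 (hermiteBasis hr).orthonormal,
          orthonormal_iff_ite.1 (hermiteBasis hr).orthonormal]
        by_cases hn : k = n <;> simp [hn]
    rw [key _ χ hχ, h0, inner_smul_left, Complex.conj_ofReal]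

/-- The annihilation operator lowers the Hermite basis. -/
theorem isLowering_annihilationOp {ħ r : ℝ} (hħ : ħ ≠ 0) (hr : 0 < r) :
    IsLowering (hermiteBasis hr) (annihilationOp ħ r) := by
  intro ψ χ
  refine ⟨inner_hermiteBasis_of_mem_graph hħ hr, fun H => ?_⟩
  set b := hermiteBasis hr
  -- `τ` will be the limit of creation applied to the Hermite partial sums `u k` of `ψ`; it is
  -- needed because `Q` and `P` are controlled only by annihilation and creation together.
  obtain ⟨τ, hτ0, hτ⟩ := exists_raised b H
  set u : ℕ → OscSpace := fun k => ∑ n ∈ Finset.range k, b.repr ψ n • b n with hu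
  have hlim : Tendsto u atTop (𝓝 ψ) := (b.hasSum_repr ψ).tendsto_sum_nat
  have hcoef : ∀ k n, inner ℂ (b n) (u k) = if n < k then inner ℂ (b n) ψ else 0 := by
    intro k n
    rw [hu, inner_sum]
    simp only [inner_smul_right, orthonormal_iff_ite.1 b.orthonormal, b.repr_apply_apply]
    simp
  have hQ : ∀ k, ∃ ξ, (u k, ξ) ∈ positionOp.graph := fun k =>
    LinearPMap.mem_domain_iff.1 (positionOp.domain.sum_mem fun n _ =>
      positionOp.domain.smul_mem _ (hermiteBasis_mem_positionOp_domain hr n))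
  have hP : ∀ k, ∃ π, (u k, π) ∈ (momentumOp ħ).graph := fun k =>
    LinearPMap.mem_domain_iff.1 ((momentumOp ħ).domain.sum_mem fun n _ =>
      (momentumOp ħ).domain.smul_mem _ (hermiteBasis_mem_momentumOp_domain hħ hr n))
  choose ξ hξ using hQ
  choose π hπ using hP
  have hev : ∀ (m : ℕ) (c : ℂ), Tendsto (fun k => if m < k then c else 0) atTop (𝓝 c) :=
    fun m c => tendsto_const_nhds.congr' (by
      filter_upwards [eventually_gt_atTop m] with k hk
      rw [if_pos hk])
  have ha : Tendsto (fun k => annihilate ħ r (ξ k) (π k)) atTop (𝓝 χ) := by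
    have hc : ∀ k n, inner ℂ (b n) (annihilate ħ r (ξ k) (π k)) =
        if n + 1 < k then inner ℂ (b n) χ else 0 := fun k n => by
      rw [inner_hermiteBasis_of_mem_graph hħ hr
        (mem_annihilationOp_graph.2 ⟨_, _, hξ k, hπ k, rfl⟩), hcoef, H]
      split_ifs <;> simp
    refine tendsto_of_dominated_inner b χ (Eventually.of_forall fun k n => ?_) fun n => ?_
    · rw [hc]
      split_ifs <;> simp
    · simp only [hc]
      exact hev _ _
  have hc : Tendsto (fun k => create ħ r (ξ k) (π k)) atTop (𝓝 τ) := by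
    have hc0 : ∀ k, inner ℂ (b 0) (create ħ r (ξ k) (π k)) = 0 := fun k =>
      (inner_hermiteBasis_create hħ hr (hξ k) (hπ k)).1
    have hc : ∀ k n, inner ℂ (b (n + 1)) (create ħ r (ξ k) (π k)) =
        if n < k then inner ℂ (b (n + 1)) τ else 0 := fun k n => by
      rw [(inner_hermiteBasis_create hħ hr (hξ k) (hπ k)).2, hcoef, hτ]
      split_ifs <;> simp
    refine tendsto_of_dominated_inner b τ (Eventually.of_forall fun k n => ?_) fun n => ?_
    · cases n with
      | zero => rw [hc0, hτ0]; simp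
      | succ n =>
        rw [hc]
        split_ifs <;> simp
    · cases n with
      | zero => simp only [hc0, hτ0]; exact tendsto_const_nhds
      | succ n =>
        simp only [hc]
        exact hev _ _
  -- Convergence of both ladder images gives convergence of `Q u_k` and `P u_k`; closedness then
  -- places `ψ` in `dom Q ∩ dom P`.
  have hξ' : Tendsto ξ atTop (𝓝 (((r / √2 : ℝ) : ℂ) • (χ + τ))) :=
    ((ha.add hc).const_smul _).congr fun k =>
      (position_eq_annihilate_add_create hr (ξ k) (π k)).symm
  have hπ' : Tendsto π atTop (𝓝 ((-(Complex.I * ((ħ / (√2 * r) : ℝ) : ℂ))) • (χ - τ))) :=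
    ((ha.sub hc).const_smul _).congr fun k =>
      (momentum_eq_annihilate_sub_create hħ hr (ξ k) (π k)).symm
  refine mem_annihilationOp_graph.2 ⟨_, _, positionOp_graph_closed hξ hlim hξ',
    momentumOp_graph_closed hħ hπ hlim hπ', ?_⟩
  refine tendsto_nhds_unique ha ?_
  exact (hξ'.add (hπ'.const_smul _)).const_smul _

theorem create_mem_adjoint_graph {ħ r : ℝ} (hħ : ħ ≠ 0) (hr : 0 < r) {ψ ξ π : OscSpace}
    (hξ : (ψ, ξ) ∈ positionOp.graph) (hπ : (ψ, π) ∈ (momentumOp ħ).graph) :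
    (ψ, create ħ r ξ π) ∈ (annihilationOp ħ r)†.graph :=
  (isLowering_annihilationOp hħ hr).mem_adjoint_graph.2 (inner_hermiteBasis_create hħ hr hξ hπ)

end


/-! ### Covariance and differentiability of the displacement operators. -/

noncomputable section

/-! ### Weyl operators -/

theorem unitaryExp_positionOp (t : ℝ) : unitaryExp positionOp t = positionGroup t :=
  unitaryExp_eq (dense_of_hilbertBasis_mem (hermiteBasis one_pos)
    (hermiteBasis_mem_positionOp_domain one_pos)) isUnitaryGroupOf_positionOp t

theorem unitaryExp_momentumOp {ħ : ℝ} (hħ : ħ ≠ 0) (t : ℝ) :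
    unitaryExp (momentumOp ħ) t = momentumGroup ħ t :=
  unitaryExp_eq (dense_of_hilbertBasis_mem (hermiteBasis one_pos)
    (hermiteBasis_mem_momentumOp_domain hħ one_pos)) (isUnitaryGroupOf_momentumOp hħ) t

theorem weylOp_apply {ħ : ℝ} (hħ : ħ ≠ 0) (q p : ℝ) (ψ : OscSpace) :
    weylOp ħ q p ψ = Complex.exp (Complex.I * (p * q / (2 * ħ) : ℝ)) •
      phaseMul (p / ħ) (translate q ψ) := by
  rw [weylOp, unitaryExp_positionOp, unitaryExp_momentumOp hħ]
  change Complex.exp (Complex.I * (p * q / (2 * ħ) : ℝ)) •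
    phaseMul (p / ħ) (translate (ħ * (q / ħ)) ψ) = _
  rw [mul_div_cancel₀ _ hħ]

/-- The Weyl form of the canonical commutation relation. -/
theorem translate_phaseMul (q s : ℝ) (ψ : OscSpace) :
    translate q (phaseMul s ψ) =
      Complex.exp ((s * q : ℝ) * Complex.I) • phaseMul s (translate q ψ) := by
  apply Lp.ext
  filter_upwards [coeFn_translate q (phaseMul s ψ), coeFn_translate q ψ,
    (measurePreserving_add_right volume q).quasiMeasurePreserving.ae (coeFn_phaseMul s ψ),
    coeFn_phaseMul s (translate q ψ), Lp.coeFn_smul (Complex.exp ((s * q : ℝ) * Complex.I))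
      (phaseMul s (translate q ψ))] with x h1 h2 h3 h4 h5
  rw [h1, h3, h5, Pi.smul_apply, h4, h2, smul_eq_mul, ← mul_assoc, ← Complex.exp_add]
  congr 2
  push_cast
  ring

theorem norm_exp_I_mul_ofReal (t : ℝ) : ‖Complex.exp (Complex.I * t)‖ = 1 := by
  rw [mul_comm, Complex.norm_exp_ofReal_mul_I]

theorem norm_weylOp {ħ : ℝ} (hħ : ħ ≠ 0) (q p : ℝ) (ψ : OscSpace) :
    ‖weylOp ħ q p ψ‖ = ‖ψ‖ := by
  rw [weylOp_apply hħ, norm_smul, norm_exp_I_mul_ofReal, one_mul, LinearIsometry.norm_map,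
    LinearIsometry.norm_map]

theorem weylOp_neg_apply_weylOp {ħ : ℝ} (hħ : ħ ≠ 0) (q p : ℝ) (ψ : OscSpace) :
    weylOp ħ (-q) (-p) (weylOp ħ q p ψ) = ψ := by
  have h1 : phaseMul (-p / ħ) (phaseMul (p / ħ) ψ) = ψ := by
    have h := congrArg (fun W : unitary (OscSpace →L[ℂ] OscSpace) => (W : OscSpace →L[ℂ] OscSpace) ψ)
      (isUnitaryGroupOf_positionOp.add (-p / ħ) (p / ħ))
    rw [neg_div, neg_add_cancel, isUnitaryGroupOf_positionOp.zero] at h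
    rw [neg_div]
    exact h.symm
  rw [weylOp_apply hħ, weylOp_apply hħ, map_smul, map_smul, translate_phaseMul, ← translate_add,
    neg_add_cancel, translate_zero, map_smul, h1, smul_smul, smul_smul, ← Complex.exp_add,
    ← Complex.exp_add]
  have h2 : Complex.I * ((-p * -q / (2 * ħ) : ℝ) : ℂ) + Complex.I * ((p * q / (2 * ħ) : ℝ) : ℂ) +
      ((p / ħ * -q : ℝ) : ℂ) * Complex.I = 0 := by
    have hħ' : (ħ : ℂ) ≠ 0 := by exact_mod_cast hħ
    push_cast
    field_simp
    ring
  rw [h2, Complex.exp_zero, one_smul]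

/-- The rule `Q W(q,p) = W(q,p)(Q - q)`: translation shifts `Q`, while the multiplication group of
`Q` commutes with `Q`. -/
theorem weylOp_mem_positionOp_graph {ħ : ℝ} (hħ : ħ ≠ 0) (q p : ℝ) {ψ ξ : OscSpace}
    (h : (ψ, ξ) ∈ positionOp.graph) :
    (weylOp ħ q p ψ, weylOp ħ q p (ξ - (q : ℂ) • ψ)) ∈ positionOp.graph := by
  have h1 : (translate q ψ, translate q (ξ - (q : ℂ) • ψ)) ∈ positionOp.graph := by
    rw [mem_positionOp_graph] at h ⊢
    filter_upwards [coeFn_translate q ψ, coeFn_translate q (ξ - (q : ℂ) • ψ),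
      (measurePreserving_add_right volume q).quasiMeasurePreserving.ae h,
      (measurePreserving_add_right volume q).quasiMeasurePreserving.ae
        (Lp.coeFn_sub ξ ((q : ℂ) • ψ)),
      (measurePreserving_add_right volume q).quasiMeasurePreserving.ae
        (Lp.coeFn_smul (q : ℂ) ψ)] with x h1 h2 h3 h4 h5
    rw [h2, h4, Pi.sub_apply, h3, h5, h1, Pi.smul_apply, smul_eq_mul]
    push_cast
    ring
  obtain ⟨u, hu, hu2⟩ := (LinearPMap.mem_graph_iff _).1 h1
  have h2 := isUnitaryGroupOf_positionOp.mem_graph u (p / ħ)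
  simp only at hu hu2
  rw [hu2, hu, positionGroup_apply, positionGroup_apply] at h2
  rw [weylOp_apply hħ, weylOp_apply hħ]
  exact positionOp.graph.smul_mem _ h2

/-- By the Weyl relation, translating `e^{isx}ψ` by `ħt` gives `e^{isx}` times `e^{isħt} T_{ħt}ψ`.
The product rule at `t = 0` produces the extra `ħs`, and the generator property puts the result in
the graph of `P`. -/
theorem phaseMul_mem_momentumOp_graph {ħ : ℝ} (hħ : ħ ≠ 0) (s : ℝ) {ψ π : OscSpace}
    (h : (ψ, π) ∈ (momentumOp ħ).graph) :
    (phaseMul s ψ, phaseMul s (π + ((ħ * s : ℝ) : ℂ) • ψ)) ∈ (momentumOp ħ).graph := by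
  obtain ⟨u, rfl, rfl⟩ := (LinearPMap.mem_graph_iff _).1 h
  rw [(isUnitaryGroupOf_momentumOp hħ).generator]
  have h1 := (isUnitaryGroupOf_momentumOp hħ).hasDerivAt u 0
  have h2 : HasDerivAt (fun t : ℝ => Complex.exp ((s * (ħ * t) : ℝ) * Complex.I))
      (Complex.exp ((s * (ħ * 0) : ℝ) * Complex.I) * ((s * (ħ * 1) : ℝ) * Complex.I)) 0 :=
    (((((hasDerivAt_id (0 : ℝ)).const_mul ħ).const_mul s).ofReal_comp).mul_const Complex.I).cexp
  have h3 := h2.smul h1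
  have h4 := (phaseMul s).toContinuousLinearMap.hasFDerivAt.restrictScalars ℝ
    |>.comp_hasDerivAt (0 : ℝ) h3
  rw [hasDerivAt_iff_tendsto_slope_zero] at h4
  convert! h4 using 1
  · funext t
    simp only [Function.comp_apply, zero_add, momentumGroup_apply, mul_zero, translate_zero,
      Complex.ofReal_zero, zero_mul, Complex.exp_zero, one_smul, Pi.smul_apply',
      LinearIsometry.coe_toContinuousLinearMap]
    rw [translate_phaseMul, map_smul, real_smul_eq, Complex.ofReal_inv]
  · congr 1
    simp only [momentumGroup_apply, mul_zero, translate_zero,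
      Complex.ofReal_zero, zero_mul, Complex.exp_zero, one_smul, mul_one, one_mul]
    change _ = phaseMul s _
    rw [← map_smul]
    congr 1
    rw [smul_add, smul_smul]
    congr 2
    push_cast
    ring

theorem weylOp_mem_momentumOp_graph {ħ : ℝ} (hħ : ħ ≠ 0) (q p : ℝ) {ψ π : OscSpace}
    (h : (ψ, π) ∈ (momentumOp ħ).graph) :
    (weylOp ħ q p ψ, weylOp ħ q p (π + (p : ℂ) • ψ)) ∈ (momentumOp ħ).graph := by
  obtain ⟨u, rfl, rfl⟩ := (LinearPMap.mem_graph_iff _).1 h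
  have h1 := (isUnitaryGroupOf_momentumOp hħ).mem_graph u (q / ħ)
  rw [momentumGroup_apply, momentumGroup_apply, mul_div_cancel₀ _ hħ] at h1
  have h2 := phaseMul_mem_momentumOp_graph hħ (p / ħ) h1
  rw [mul_div_cancel₀ _ hħ, ← map_smul, ← map_add] at h2
  rw [weylOp_apply hħ, weylOp_apply hħ]
  exact (momentumOp ħ).graph.smul_mem _ h2

/-! ### Displacement operators -/

theorem norm_displacementOp {ħ : ℝ} (hħ : ħ ≠ 0) (r : ℝ) (z : ℂ) (ψ : OscSpace) :
    ‖displacementOp ħ r z ψ‖ = ‖ψ‖ := norm_weylOp hħ _ _ ψ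

theorem displacementOp_neg_apply {ħ : ℝ} (hħ : ħ ≠ 0) (r : ℝ) (z : ℂ) (ψ : OscSpace) :
    displacementOp ħ r (-z) (displacementOp ħ r z ψ) = ψ := by
  have h := weylOp_neg_apply_weylOp hħ (-(√2 * r * z.re)) (√2 * ħ * z.im / r) ψ
  rw [displacementOp, displacementOp, Complex.neg_re, Complex.neg_im, mul_neg, mul_neg, neg_div]
  exact h

theorem displacementOp_apply_neg {ħ : ℝ} (hħ : ħ ≠ 0) (r : ℝ) (z : ℂ) (ψ : OscSpace) :
    displacementOp ħ r z (displacementOp ħ r (-z) ψ) = ψ := by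
  have h := displacementOp_neg_apply hħ r (-z) ψ
  rwa [neg_neg] at h

theorem inner_displacementOp {ħ : ℝ} (hħ : ħ ≠ 0) (r : ℝ) (z : ℂ) (ψ χ : OscSpace) :
    inner ℂ (displacementOp ħ r z ψ) (displacementOp ħ r z χ) = inner ℂ ψ χ :=
  LinearIsometry.inner_map_map
    ⟨(displacementOp ħ r z : OscSpace →ₗ[ℂ] OscSpace), norm_displacementOp hħ r z⟩ ψ χ

theorem star_displacementOp {ħ : ℝ} (hħ : ħ ≠ 0) (r : ℝ) (z : ℂ) :
    star (displacementOp ħ r z) = displacementOp ħ r (-z) := by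
  rw [ContinuousLinearMap.star_eq_adjoint, eq_comm, ContinuousLinearMap.eq_adjoint_iff]
  intro ψ χ
  rw [← inner_displacementOp hħ r z, displacementOp_apply_neg hħ]

/-- `D(z)† a D(z) = a + z`. -/
theorem displacementOp_mem_annihilationOp_graph {ħ r : ℝ} (hħ : ħ ≠ 0) (hr : r ≠ 0) (z : ℂ)
    {ψ χ : OscSpace} (h : (ψ, χ) ∈ (annihilationOp ħ r).graph) :
    (displacementOp ħ r z ψ, displacementOp ħ r z (χ + z • ψ)) ∈ (annihilationOp ħ r).graph := by
  obtain ⟨ξ, π, h1, h2, rfl⟩ := mem_annihilationOp_graph.1 h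
  refine mem_annihilationOp_graph.2 ⟨_, _, weylOp_mem_positionOp_graph hħ _ _ h1,
    weylOp_mem_momentumOp_graph hħ _ _ h2, ?_⟩
  -- The scalings in `D(z)` are such that `(-q + i (r²/ħ) p) / (√2 r) = Re z + i Im z`.
  rw [displacementOp, annihilate, annihilate, ← map_smul, ← map_add, ← map_smul]
  congr 1
  have hħ' : (ħ : ℂ) ≠ 0 := by exact_mod_cast hħ
  have hr' : (r : ℂ) ≠ 0 := by exact_mod_cast hr
  have h2 : ((√2 : ℝ) : ℂ) ≠ 0 := by simp
  match_scalars <;> field_simp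
  linear_combination -Complex.re_add_im z

/-- `D(z)† a† D(z) = a† + conj z`. -/
theorem displacementOp_mem_adjoint_graph {ħ r : ℝ} (hħ : ħ ≠ 0) (hr : 0 < r) (z : ℂ)
    {ψ χ : OscSpace} (h : (ψ, χ) ∈ (annihilationOp ħ r)†.graph) :
    (displacementOp ħ r z ψ, displacementOp ħ r z (χ + conj z • ψ)) ∈
      (annihilationOp ħ r)†.graph := by
  have hd := (isLowering_annihilationOp hħ hr).dense
  rw [mem_adjoint_graph_iff hd] at h ⊢
  intro ξ τ hξ
  have h1 := h _ _ (displacementOp_mem_annihilationOp_graph hħ hr.ne' (-z) hξ)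
  rw [← inner_displacementOp hħ r z, ← inner_displacementOp hħ r z ψ,
    displacementOp_apply_neg hħ, displacementOp_apply_neg hħ, inner_add_right,
    inner_smul_right] at h1
  rw [map_add, inner_add_left, map_smul, inner_smul_left, Complex.conj_conj, h1]
  ring

theorem tendsto_isometry_apply {X E : Type*} [NormedAddCommGroup E] [NormedSpace ℂ E]
    {l : Filter X} {V : X → E →L[ℂ] E} {ξ : X → E} {ξ₀ : E} {V₀ : E →L[ℂ] E}
    (hV : ∀ y ψ, ‖V y ψ‖ = ‖ψ‖) (hc : Tendsto (fun y => V y ξ₀) l (𝓝 (V₀ ξ₀)))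
    (hξ : Tendsto ξ l (𝓝 ξ₀)) : Tendsto (fun y => V y (ξ y)) l (𝓝 (V₀ ξ₀)) := by
  have h1 : Tendsto (fun y => V y (ξ y - ξ₀)) l (𝓝 0) := by
    rw [tendsto_zero_iff_norm_tendsto_zero]
    simp only [hV]
    exact tendsto_iff_norm_sub_tendsto_zero.1 hξ
  have h2 := h1.add hc
  rw [zero_add] at h2
  exact h2.congr fun y => by rw [map_sub, sub_add_cancel]

theorem displacementOp_apply {ħ : ℝ} (hħ : ħ ≠ 0) (r : ℝ) (z : ℂ) (ψ : OscSpace) :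
    displacementOp ħ r z ψ =
      Complex.exp (Complex.I * (√2 * ħ * z.im / r * -(√2 * r * z.re) / (2 * ħ) : ℝ)) •
      phaseMul (√2 * ħ * z.im / r / ħ) (translate (-(√2 * r * z.re)) ψ) :=
  weylOp_apply hħ _ _ ψ

theorem continuous_displacementOp {ħ : ℝ} (hħ : ħ ≠ 0) (r : ℝ) (ψ : OscSpace) :
    Continuous fun z => displacementOp ħ r z ψ := by
  simp only [displacementOp_apply hħ]
  have h : Continuous fun z : ℂ => Complex.exp (Complex.I *
      (√2 * ħ * z.im / r * -(√2 * r * z.re) / (2 * ħ) : ℝ)) := by fun_prop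
  refine h.smul ?_
  rw [continuous_iff_continuousAt]
  intro z
  refine tendsto_isometry_apply
    (V := fun z : ℂ => (positionGroup (√2 * ħ * z.im / r / ħ) : OscSpace →L[ℂ] OscSpace))
    (V₀ := (positionGroup (√2 * ħ * z.im / r / ħ) : OscSpace →L[ℂ] OscSpace))
    (ξ := fun z : ℂ => translate (-(√2 * r * z.re)) ψ)
    (fun y ψ => norm_unitary_apply _ ψ) ?_ ?_
  · exact ((isUnitaryGroupOf_positionOp.continuous _).comp
      (f := fun z : ℂ => √2 * ħ * z.im / r / ħ) (by fun_prop)).tendsto z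
  · exact ((continuous_translate ψ).comp
      (f := fun z : ℂ => -(√2 * r * z.re)) (by fun_prop)).tendsto z

theorem hasFDerivAt_cexp_I_mul_ofReal {X : Type*} [NormedAddCommGroup X] [NormedSpace ℝ X]
    {g : X → ℝ} {g' : X →L[ℝ] ℝ} {x : X} (hg : HasFDerivAt g g' x) :
    HasFDerivAt (fun y => Complex.exp (Complex.I * g y))
      (g'.smulRight (Complex.I * Complex.exp (Complex.I * g x))) x := by
  have h : HasDerivAt (fun t : ℝ => Complex.exp (Complex.I * t))
      (Complex.I * Complex.exp (Complex.I * g x)) (g x) := by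
    have := ((hasDerivAt_id (g x)).ofReal_comp.const_mul Complex.I).cexp
    simpa [mul_comm] using this
  refine (h.hasFDerivAt.comp x hg).congr_fderiv ?_
  ext v
  simp

/-- The derivative of `z ↦ D(z) ψ` in the direction `δ` is
`D(z) (δ a† - conj δ a + i Im (conj z δ)) ψ`. -/
theorem exists_hasFDerivAt_displacementOp {ħ r : ℝ} (hħ : ħ ≠ 0) (hr : r ≠ 0)
    {ψ ξ π : OscSpace} (hξ : (ψ, ξ) ∈ positionOp.graph) (hπ : (ψ, π) ∈ (momentumOp ħ).graph)
    (z : ℂ) : ∃ L : ℂ →L[ℝ] OscSpace, HasFDerivAt (fun z => displacementOp ħ r z ψ) L z ∧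
      ∀ δ, L δ = displacementOp ħ r z (δ • create ħ r ξ π - conj δ • annihilate ħ r ξ π +
        (Complex.I * ((conj z * δ).im : ℂ)) • ψ) := by
  have hq : HasFDerivAt (fun z : ℂ => -(√2 * r * z.re)) (-((√2 * r) • Complex.reCLM)) z :=
    (Complex.reCLM.hasFDerivAt.const_mul (√2 * r)).neg
  have hp : HasFDerivAt (fun z : ℂ => √2 * ħ * z.im / r) ((√2 * ħ / r) • Complex.imCLM) z := by
    have := (Complex.imCLM.hasFDerivAt (x := z)).const_mul (√2 * ħ / r)
    refine this.congr_of_eventuallyEq (Eventually.of_forall fun w => ?_)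
    simp only [Complex.imCLM_apply]
    ring
  have hT : ∀ q, HasDerivAt (fun q => translate q ψ)
      ((ħ : ℂ)⁻¹ • translate q (Complex.I • π)) q := by
    intro q
    obtain ⟨u, rfl, rfl⟩ := (LinearPMap.mem_graph_iff _).1 hπ
    have h1 := (isUnitaryGroupOf_momentumOp hħ).hasDerivAt u (q / ħ)
    have h2 := h1.scomp q ((hasDerivAt_id q).div_const ħ)
    simp only [momentumGroup_apply, Function.comp_def, id, mul_div_cancel₀ _ hħ] at h2
    rw [real_smul_eq] at h2
    simpa using h2
  -- A Weyl operator with `p = 0` is a plain translation, so the covariance of `Q` keeps the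
  -- translated vector in `dom Q`, where the phase factor can be differentiated.
  have hξ' : (translate (-(√2 * r * z.re)) ψ, translate (-(√2 * r * z.re))
      (ξ - ((-(√2 * r * z.re) : ℝ) : ℂ) • ψ)) ∈ positionOp.graph := by
    have h := weylOp_mem_positionOp_graph hħ (-(√2 * r * z.re)) 0 hξ
    rw [weylOp_apply hħ, weylOp_apply hħ] at h
    have h0 : ∀ χ, phaseMul 0 χ = χ := fun χ => by
      have := isUnitaryGroupOf_positionOp.zero
      exact congrArg (fun W : unitary (OscSpace →L[ℂ] OscSpace) =>
        (W : OscSpace →L[ℂ] OscSpace) χ) this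
    simpa [h0] using h
  have hM : ∀ p, HasDerivAt (fun p => phaseMul (p / ħ) (translate (-(√2 * r * z.re)) ψ))
      ((ħ : ℂ)⁻¹ • phaseMul (p / ħ) (Complex.I • translate (-(√2 * r * z.re))
      (ξ - ((-(√2 * r * z.re) : ℝ) : ℂ) • ψ))) p := by
    intro p
    obtain ⟨u, hu, hu2⟩ := (LinearPMap.mem_graph_iff _).1 hξ'
    have h1 := isUnitaryGroupOf_positionOp.hasDerivAt u (p / ħ)
    have h2 := h1.scomp p ((hasDerivAt_id p).div_const ħ)
    simp only at hu hu2
    rw [hu, hu2] at h2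
    simp only [positionGroup_apply, Function.comp_def, id] at h2
    rw [real_smul_eq] at h2
    simpa using h2
  have hT' := (hT (-(√2 * r * z.re))).hasFDerivAt.comp z hq
  have hM' := (hM (√2 * ħ * z.im / r)).hasFDerivAt.comp z hp
  have hprod := hasFDerivAt_isometry_apply
    (V := fun z : ℂ => (positionGroup (√2 * ħ * z.im / r / ħ) : OscSpace →L[ℂ] OscSpace))
    (ξ := fun z : ℂ => translate (-(√2 * r * z.re)) ψ)
    (fun y ψ => norm_unitary_apply _ ψ)
    (fun χ => ((isUnitaryGroupOf_positionOp.continuous χ).comp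
      (f := fun z : ℂ => √2 * ħ * z.im / r / ħ) (by fun_prop)).continuousAt)
    hT' hM'
  have hα := hasFDerivAt_cexp_I_mul_ofReal ((hp.mul hq).mul_const (2 * ħ)⁻¹)
  have hall := hα.smul hprod
  refine ⟨_, hall.congr_of_eventuallyEq (Eventually.of_forall fun w => ?_), fun δ => ?_⟩
  · simp only [displacementOp_apply hħ, div_eq_mul_inv _ (2 * ħ)]
    rfl
  · rw [displacementOp_apply hħ, create, annihilate]
    change Complex.exp (Complex.I * (√2 * ħ * z.im / r * -(√2 * r * z.re) * (2 * ħ)⁻¹ : ℝ)) •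
        ((√2 * ħ / r * δ.im) • ((ħ : ℂ)⁻¹ • phaseMul (√2 * ħ * z.im / r / ħ) (Complex.I •
            translate (-(√2 * r * z.re)) (ξ - ((-(√2 * r * z.re) : ℝ) : ℂ) • ψ))) +
          phaseMul (√2 * ħ * z.im / r / ħ) ((-(√2 * r * δ.re)) • ((ħ : ℂ)⁻¹ •
            translate (-(√2 * r * z.re)) (Complex.I • π)))) +
      (((2 * ħ)⁻¹ * (√2 * ħ * z.im / r * -(√2 * r * δ.re) + -(√2 * r * z.re) *
          (√2 * ħ / r * δ.im))) • (Complex.I * Complex.exp (Complex.I *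
            (√2 * ħ * z.im / r * -(√2 * r * z.re) * (2 * ħ)⁻¹ : ℝ)))) •
        phaseMul (√2 * ħ * z.im / r / ħ) (translate (-(√2 * r * z.re)) ψ) = _
    simp only [real_smul_eq, map_smul, map_sub, map_add, Complex.real_smul]
    -- Only the transported images of `ψ`, `Qψ` and `Pψ` occur; their coefficients are compared as
    -- scalars in the real and imaginary parts of `z` and `δ`.
    generalize phaseMul (√2 * ħ * z.im / r / ħ) (translate (-(√2 * r * z.re)) ψ) = ψ'
    generalize phaseMul (√2 * ħ * z.im / r / ħ) (translate (-(√2 * r * z.re)) ξ) = ξ'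
    generalize phaseMul (√2 * ħ * z.im / r / ħ) (translate (-(√2 * r * z.re)) π) = π'
    rw [← div_eq_mul_inv _ (2 * ħ)]
    generalize Complex.exp _ = e
    have hδ : conj δ = δ.re - δ.im * Complex.I := by
      apply Complex.ext <;> simp
    have hδ' : δ = δ.re + δ.im * Complex.I := (Complex.re_add_im δ).symm
    have him : (conj z * δ).im = z.re * δ.im - z.im * δ.re := by
      simp
      ring
    have h2 : ((√2 : ℝ) : ℂ) ≠ 0 := by simp
    have h22 : ((√2 : ℝ) : ℂ) ^ 2 = 2 := by
      rw [← Complex.ofReal_pow, Real.sq_sqrt (by norm_num)]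
      norm_num
    have hħ' : (ħ : ℂ) ≠ 0 := by exact_mod_cast hħ
    have hr' : (r : ℂ) ≠ 0 := by exact_mod_cast hr
    rw [hδ, him]
    generalize hx : δ.re = x at *
    generalize hy : δ.im = y at *
    rw [hδ']
    match_scalars <;> field_simp <;> rw [h22] <;> ring

end


/-! ### The ladder images along the field, its derivative and the potential. -/

noncomputable section

/-! ### The common domain of the ladder operators and the number operator -/

/-- `ψ` is in the domain of the number operator, and `α = a ψ`, `β = a† ψ`, `ν = a† a ψ`. -/
structure LadderImages (ħ r : ℝ) (ψ α β ν : OscSpace) : Prop where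
  lower : (ψ, α) ∈ (annihilationOp ħ r).graph
  raise : (ψ, β) ∈ (annihilationOp ħ r)†.graph
  number : (α, ν) ∈ (annihilationOp ħ r)†.graph

variable {ħ r : ℝ} {ψ α β ν : OscSpace}

theorem LadderImages.mem_number_graph (h : LadderImages ħ r ψ α β ν) :
    (ψ, ν) ∈ (numberOp ħ r).graph := mem_opMul_graph.2 ⟨α, h.lower, h.number⟩

theorem exists_ladderImages (hħ : 0 < ħ) (hr : 0 < r) (h : (ψ, ν) ∈ (numberOp ħ r).graph) :
    ∃ α β, LadderImages ħ r ψ α β ν := by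
  obtain ⟨α, h1, h2⟩ := mem_opMul_graph.1 h
  have h3 : ψ ∈ (annihilationOp ħ r)†.domain := by
    rw [(isLowering_annihilationOp hħ.ne' hr).adjoint_domain]
    exact LinearPMap.mem_domain_of_mem_graph h1
  obtain ⟨β, hβ⟩ := LinearPMap.mem_domain_iff.1 h3
  exact ⟨α, β, h1, hβ, h2⟩

theorem LadderImages.smul (h : LadderImages ħ r ψ α β ν) (c : ℂ) :
    LadderImages ħ r (c • ψ) (c • α) (c • β) (c • ν) :=
  ⟨Submodule.smul_mem _ c h.lower, Submodule.smul_mem _ c h.raise,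
    Submodule.smul_mem _ c h.number⟩

/-- The last entry is `(a + z)†(a + z)ψ` expanded; in particular `D(z)` preserves the domain of the
number operator. -/
theorem LadderImages.displace (hħ : 0 < ħ) (hr : 0 < r) (h : LadderImages ħ r ψ α β ν) (z : ℂ) :
    LadderImages ħ r (displacementOp ħ r z ψ) (displacementOp ħ r z (α + z • ψ))
      (displacementOp ħ r z (β + conj z • ψ))
      (displacementOp ħ r z (ν + z • β + conj z • (α + z • ψ))) :=
  ⟨displacementOp_mem_annihilationOp_graph hħ.ne' hr.ne' z h.lower,
    displacementOp_mem_adjoint_graph hħ.ne' hr z h.raise,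
    displacementOp_mem_adjoint_graph hħ.ne' hr z
      (Submodule.add_mem _ h.number (Submodule.smul_mem _ z h.raise))⟩

/-- The unitary group `e^{iθ a†a}`. -/
def numberGroup (hr : 0 < r) : ℝ → unitary (OscSpace →L[ℂ] OscSpace) :=
  diagonalGroup (hermiteBasis hr) fun n => n

theorem isUnitaryGroupOf_numberOp (hħ : 0 < ħ) (hr : 0 < r) :
    IsUnitaryGroupOf (numberOp ħ r) (numberGroup hr) :=
  isUnitaryGroupOf_diagonal _ _ fun _ _ =>
    (isLowering_annihilationOp hħ.ne' hr).mem_number_graph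

theorem unitaryExp_numberOp (hħ : 0 < ħ) (hr : 0 < r) (θ : ℝ) :
    unitaryExp (numberOp ħ r) θ = numberGroup hr θ :=
  unitaryExp_eq (isSelfAdjoint_of_diagonal (hermiteBasis hr) (fun n => n) fun _ _ =>
    (isLowering_annihilationOp hħ.ne' hr).mem_number_graph).dense_domain
    (isUnitaryGroupOf_numberOp hħ hr) θ

theorem inner_numberGroup (hr : 0 < r) (θ : ℝ) (ψ : OscSpace) (n : ℕ) :
    inner ℂ (hermiteBasis hr n) ((numberGroup hr θ : OscSpace →L[ℂ] OscSpace) ψ) =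
      Complex.exp (n * (Complex.I * θ)) * inner ℂ (hermiteBasis hr n) ψ := by
  rw [numberGroup, inner_diagonalGroup]
  congr 2
  push_cast
  ring

/-- The `n`-th coefficient acquires `e^{inθ}`, and `a`, `a†` shift `n` by one, which leaves a phase
`e^{±iθ}`. For `a†a` the two phases cancel. -/
theorem LadderImages.rotate (hħ : 0 < ħ) (hr : 0 < r) (h : LadderImages ħ r ψ α β ν) (θ : ℝ) :
    LadderImages ħ r ((numberGroup hr θ : OscSpace →L[ℂ] OscSpace) ψ)
      (Complex.exp (Complex.I * θ) • (numberGroup hr θ : OscSpace →L[ℂ] OscSpace) α)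
      (Complex.exp (-(Complex.I * θ)) • (numberGroup hr θ : OscSpace →L[ℂ] OscSpace) β)
      ((numberGroup hr θ : OscSpace →L[ℂ] OscSpace) ν) := by
  have hL := isLowering_annihilationOp hħ.ne' hr
  have hadj : ∀ {ψ β : OscSpace}, (ψ, β) ∈ (annihilationOp ħ r)†.graph →
      ((numberGroup hr θ : OscSpace →L[ℂ] OscSpace) ψ,
      Complex.exp (-(Complex.I * θ)) • (numberGroup hr θ : OscSpace →L[ℂ] OscSpace) β) ∈
      (annihilationOp ħ r)†.graph := by
    intro ψ β h
    rw [hL.mem_adjoint_graph] at h ⊢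
    refine ⟨?_, fun n => ?_⟩
    · rw [inner_smul_right, inner_numberGroup, h.1, mul_zero, mul_zero]
    · rw [inner_smul_right, inner_numberGroup, inner_numberGroup, h.2, ← mul_assoc,
        ← Complex.exp_add]
      have : -(Complex.I * θ) + ((n + 1 : ℕ) : ℂ) * (Complex.I * θ) = n * (Complex.I * θ) := by
        push_cast
        ring
      rw [this]
      ring
  refine ⟨?_, hadj h.raise, ?_⟩
  · have h1 := h.lower
    rw [hL] at h1 ⊢
    intro n
    rw [inner_smul_right, inner_numberGroup, inner_numberGroup, h1, ← mul_assoc,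
      ← Complex.exp_add]
    have : Complex.I * θ + n * (Complex.I * θ) = ((n + 1 : ℕ) : ℂ) * (Complex.I * θ) := by
      push_cast
      ring
    rw [this]
    ring
  · have h1 := Submodule.smul_mem _ (Complex.exp (Complex.I * θ)) (hadj h.number)
    rw [Prod.smul_mk, smul_smul, ← Complex.exp_add, add_neg_cancel, Complex.exp_zero,
      one_smul] at h1
    exact h1

theorem LadderImages.exists_hasFDerivAt_displacementOp (hħ : 0 < ħ) (hr : 0 < r)
    (h : LadderImages ħ r ψ α β ν) (z : ℂ) :
    ∃ L : ℂ →L[ℝ] OscSpace, HasFDerivAt (fun z => displacementOp ħ r z ψ) L z ∧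
      ∀ δ, L δ = displacementOp ħ r z (δ • β - conj δ • α +
        (Complex.I * ((conj z * δ).im : ℂ)) • ψ) := by
  obtain ⟨ξ, π, h1, h2, rfl⟩ := mem_annihilationOp_graph.1 h.lower
  have h3 := LinearPMap.mem_graph_snd_inj _ h.raise
    (create_mem_adjoint_graph hħ.ne' hr h1 h2) rfl
  subst h3
  exact OscillatorField.exists_hasFDerivAt_displacementOp hħ.ne' hr.ne' h1 h2 z

/-! ### The field -/

variable {f : Minkowski → ℂ} {φ γ : Minkowski → ℝ}

theorem gaugeOp_apply (hħ : 0 < ħ) (hr : 0 < r) (x : Minkowski) (ζ : OscSpace) :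
    gaugeOp ħ r f φ γ x ζ = Complex.exp (Complex.I * φ x) • displacementOp ħ r (-f x)
      ((numberGroup hr (γ x) : OscSpace →L[ℂ] OscSpace) (displacementOp ħ r (f x) ζ)) := by
  rw [gaugeOp, star_displacementOp hħ.ne', unitaryExp_numberOp hħ hr]
  rfl

/-- Each unitary factor is differentiated at a vector of the domain of `a†a`: `D(f)` at `ζ`,
`e^{iγN}` at `D(f)ζ`, and `D(-f)` at `e^{iγN}D(f)ζ`. The equations for `z`, `e`, `V` name the frozen
values, so that the formula is linear in opaque symbols. -/
theorem exists_hasFDerivAt_gaugeOp (hħ : 0 < ħ) (hr : 0 < r) {ζ : OscSpace}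
    (h : LadderImages ħ r ζ α β ν) {x : Minkowski} {f' : Minkowski →L[ℝ] ℂ}
    {φ' γ' : Minkowski →L[ℝ] ℝ} (hf : HasFDerivAt f f' x) (hφ : HasFDerivAt φ φ' x)
    (hγ : HasFDerivAt γ γ' x) {z e : ℂ} (hz : f x = z)
    (he : Complex.exp (Complex.I * φ x) = e) {V : OscSpace →L[ℂ] OscSpace}
    (hV : (numberGroup hr (γ x) : OscSpace →L[ℂ] OscSpace) = V) {α₂ β₂ ν₁ : OscSpace}
    (h₁ : (displacementOp ħ r z ζ, ν₁) ∈ (numberOp ħ r).graph)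
    {ν₂ : OscSpace} (h₂ : LadderImages ħ r (V (displacementOp ħ r z ζ)) α₂ β₂ ν₂) :
    ∃ G : Minkowski →L[ℝ] OscSpace, HasFDerivAt (fun x => gaugeOp ħ r f φ γ x ζ) G x ∧
      ∀ v, G v = e • (displacementOp ħ r (-z) (-f' v • β₂ - conj (-f' v) • α₂ +
          (Complex.I * ((conj (-z) * -f' v).im : ℂ)) • V (displacementOp ħ r z ζ)) +
        displacementOp ħ r (-z) ((γ' v : ℂ) • V (Complex.I • ν₁) +
          V (displacementOp ħ r z (f' v • β - conj (f' v) • α +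
            (Complex.I * ((conj z * f' v).im : ℂ)) • ζ)))) +
        ((φ' v : ℂ) * (Complex.I * e)) •
          displacementOp ħ r (-z) (V (displacementOp ħ r z ζ)) := by
  subst hz he hV
  obtain ⟨L1, hL1, hL1'⟩ := h.exists_hasFDerivAt_displacementOp hħ hr (f x)
  obtain ⟨L3, hL3, hL3'⟩ := h₂.exists_hasFDerivAt_displacementOp hħ hr (-f x)
  have hU := isUnitaryGroupOf_numberOp hħ hr
  have hξ1 := hL1.comp x hf
  have hN : HasDerivAt (fun t => (numberGroup hr t : OscSpace →L[ℂ] OscSpace)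
      (displacementOp ħ r (f x) ζ))
      ((numberGroup hr (γ x) : OscSpace →L[ℂ] OscSpace) (Complex.I • ν₁)) (γ x) := by
    obtain ⟨u, hu, hu2⟩ := (LinearPMap.mem_graph_iff _).1 h₁
    have := hU.hasDerivAt u (γ x)
    simp only at hu hu2
    rwa [hu, hu2] at this
  have hξ2 := hasFDerivAt_isometry_apply
    (V := fun y => (numberGroup hr (γ y) : OscSpace →L[ℂ] OscSpace))
    (ξ := fun y => displacementOp ħ r (f y) ζ)
    (fun y χ => norm_unitary_apply _ χ)
    (fun χ => ((hU.continuous χ).continuousAt).comp hγ.continuousAt)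
    hξ1 (hN.hasFDerivAt.comp x hγ)
  have hneg : HasFDerivAt (fun y => -f y) (-f') x := hf.neg
  have hξ3 := hasFDerivAt_isometry_apply
    (V := fun y => displacementOp ħ r (-f y))
    (ξ := fun y => (numberGroup hr (γ y) : OscSpace →L[ℂ] OscSpace)
      (displacementOp ħ r (f y) ζ))
    (fun y χ => norm_displacementOp hħ.ne' r _ χ)
    (fun χ => ContinuousAt.comp (g := fun w => displacementOp ħ r w χ)
      (continuous_displacementOp hħ.ne' r χ).continuousAt hf.continuousAt.neg)
    hξ2 (HasFDerivAt.comp (g := fun w => displacementOp ħ r w _) x hL3 hneg)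
  have hall := (hasFDerivAt_cexp_I_mul_ofReal hφ).smul hξ3
  refine ⟨_, hall.congr_of_eventuallyEq (Eventually.of_forall fun y =>
    gaugeOp_apply hħ hr y ζ), fun v => ?_⟩
  rw [← hL3', ← hL1', ← real_smul_eq, ← Complex.real_smul]
  rfl

/-! ### The potential -/

theorem mem_shifted_graph {z : ℂ} {χ : OscSpace} :
    (ψ, χ) ∈ (shiftedAnnihilationOp ħ r z).graph ↔
      (ψ, χ - z • ψ) ∈ (annihilationOp ħ r).graph := by
  rw [LinearPMap.mem_graph_iff, LinearPMap.mem_graph_iff]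
  constructor
  · rintro ⟨u, rfl, h⟩
    exact ⟨u, rfl, eq_sub_of_add_eq (a := annihilationOp ħ r u) (c := z • (u : OscSpace))
      ((add_comm _ _).trans h)⟩
  · rintro ⟨u, rfl, h⟩
    exact ⟨u, rfl, add_eq_of_eq_sub' (a := z • (u : OscSpace)) (b := annihilationOp ħ r u) h⟩

theorem mem_shifted_adjoint_graph (hħ : 0 < ħ) (hr : 0 < r) {z : ℂ} {χ : OscSpace} :
    (ψ, χ) ∈ (shiftedAnnihilationOp ħ r z)†.graph ↔
      (ψ, χ - conj z • ψ) ∈ (annihilationOp ħ r)†.graph := by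
  have hd := (isLowering_annihilationOp hħ.ne' hr).dense
  have hd' : Dense ((shiftedAnnihilationOp ħ r z).domain : Set OscSpace) := hd
  rw [mem_adjoint_graph_iff hd, mem_adjoint_graph_iff hd']
  constructor
  · intro H ξ τ h
    have := H ξ (τ + z • ξ) (mem_shifted_graph.2 (by rwa [add_sub_cancel_right]))
    rw [inner_sub_left, inner_smul_left, Complex.conj_conj, this, inner_add_right,
      inner_smul_right, add_sub_cancel_right]
  · intro H ξ τ h
    have := H _ _ (mem_shifted_graph.1 h)
    rw [inner_sub_left, inner_smul_left, Complex.conj_conj, inner_sub_right,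
      inner_smul_right] at this
    exact sub_left_injective this

variable {μ : Fin 4} {x : Minkowski}

theorem partialDeriv_conj (hf : DifferentiableAt ℝ f x) :
    partialDeriv μ (fun y => conj (f y)) x = conj (partialDeriv μ f x) := by
  have h := (Complex.conjCLE.toContinuousLinearMap.hasFDerivAt.comp x hf.hasFDerivAt)
  have h2 : HasFDerivAt (fun y => conj (f y))
    (Complex.conjCLE.toContinuousLinearMap.comp (fderiv ℝ f x)) x := h
  rw [partialDeriv, h2.fderiv]
  rfl

/-- Scalar multiples keep their domain even for coefficient zero, so the quadratic term is the
restrictive one. Since `dom a† = dom a`, for `ψ ∈ dom a` the shift by `f ψ` does not affect whether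
the image lies in `dom a†`. -/
theorem potentialOp_domain (hħ : 0 < ħ) (hr : 0 < r) :
    (potentialOp ħ r f φ γ μ x).domain = (numberOp ħ r).domain := by
  have hL := isLowering_annihilationOp hħ.ne' hr
  have hd : (shiftedAnnihilationOp ħ r (f x))†.domain = (annihilationOp ħ r).domain := by
    rw [← hL.adjoint_domain]
    ext ψ
    rw [LinearPMap.mem_domain_iff, LinearPMap.mem_domain_iff]
    constructor
    · rintro ⟨χ, hχ⟩
      exact ⟨_, (mem_shifted_adjoint_graph hħ hr).1 hχ⟩
    · rintro ⟨χ, hχ⟩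
      exact ⟨χ + conj (f x) • ψ, (mem_shifted_adjoint_graph hħ hr).2
        (by rwa [add_sub_cancel_right])⟩
  have hN : (opMul (shiftedAnnihilationOp ħ r (f x))† (shiftedAnnihilationOp ħ r (f x))).domain =
      (numberOp ħ r).domain := by
    ext ψ
    rw [mem_opMul_domain, numberOp, mem_opMul_domain, hd, hL.adjoint_domain]
    refine exists_congr fun h => ?_
    change f x • ψ + annihilationOp ħ r ⟨ψ, h⟩ ∈ _ ↔ _
    exact Submodule.add_mem_iff_right _ (Submodule.smul_mem _ _ h)
  have hle : (numberOp ħ r).domain ≤ (annihilationOp ħ r).domain := fun ψ hψ =>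
    ((mem_opMul_domain _ _ ψ).1 hψ).1
  change ((⊤ ⊓ (opMul (shiftedAnnihilationOp ħ r (f x))†
    (shiftedAnnihilationOp ħ r (f x))).domain) ⊓ (shiftedAnnihilationOp ħ r (f x))†.domain) ⊓
      (annihilationOp ħ r).domain = _
  rw [hN, hd, top_inf_eq, inf_eq_left.2 hle, inf_eq_left.2 hle]

theorem potentialOp_apply (hħ : 0 < ħ) (hr : 0 < r) (h : LadderImages ħ r ψ α β ν)
    (hf : DifferentiableAt ℝ f x) (hd : ψ ∈ (potentialOp ħ r f φ γ μ x).domain)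
    {z θ δ : ℂ} {p g : ℝ} (hz : f x = z) (hθ : Complex.I * γ x = θ)
    (hδ : partialDeriv μ f x = δ) (hp : partialDeriv μ φ x = p) (hg : partialDeriv μ γ x = g) :
    potentialOp ħ r f φ γ μ x ⟨ψ, hd⟩ =
      (-(ħ * p) : ℂ) • ψ - (ħ * g : ℂ) • (ν + z • β + conj z • (α + z • ψ)) +
      (Complex.I * ħ * (Complex.exp θ - 1) * δ) • (β + conj z • ψ) -
      (Complex.I * ħ * (Complex.exp (-θ) - 1) * conj δ) • (α + z • ψ) := by
  subst hz hθ hδ hp hg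
  have happ : ∀ {A : OscSpace →ₗ.[ℂ] OscSpace} {χ : OscSpace} (hm : ψ ∈ A.domain),
      (ψ, χ) ∈ A.graph → A ⟨ψ, hm⟩ = χ := fun {A χ} hm hg =>
    LinearPMap.mem_graph_snd_inj _ (A.mem_graph ⟨ψ, hm⟩) hg rfl
  have h1 : (ψ, α + f x • ψ) ∈ (shiftedAnnihilationOp ħ r (f x)).graph :=
    mem_shifted_graph.2 (by rw [add_sub_cancel_right]; exact h.lower)
  have h2 : (ψ, β + conj (f x) • ψ) ∈ (shiftedAnnihilationOp ħ r (f x))†.graph :=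
    (mem_shifted_adjoint_graph hħ hr).2 (by rw [add_sub_cancel_right]; exact h.raise)
  have h3 : (ψ, ν + f x • β + conj (f x) • (α + f x • ψ)) ∈
      (opMul (shiftedAnnihilationOp ħ r (f x))† (shiftedAnnihilationOp ħ r (f x))).graph :=
    mem_opMul_graph.2 ⟨_, h1, (mem_shifted_adjoint_graph hħ hr).2 (by
      rw [add_sub_cancel_right]
      exact Submodule.add_mem _ h.number (Submodule.smul_mem _ _ h.raise))⟩
  have d1 := LinearPMap.mem_domain_of_mem_graph h1
  have d2 := LinearPMap.mem_domain_of_mem_graph h2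
  have d3 := LinearPMap.mem_domain_of_mem_graph h3
  have e1 := happ d1 h1
  have e2 := happ d2 h2
  have e3 := happ d3 h3
  rw [← partialDeriv_conj hf, ← e3, ← e1, ← e2, ← Complex.ofReal_mul, ← Complex.ofReal_mul,
    ← Complex.ofReal_neg]
  rfl

/-- The Hilbert basis `D(w)† b_n`. -/
def displacedBasis (hħ : 0 < ħ) (hr : 0 < r) (w : ℂ) : HilbertBasis ℕ ℂ OscSpace :=
  HilbertBasis.ofRepr (LinearIsometryEquiv.trans
    { toLinearEquiv := LinearEquiv.ofLinearMap (displacementOp ħ r w : OscSpace →ₗ[ℂ] OscSpace)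
        (displacementOp ħ r (-w) : OscSpace →ₗ[ℂ] OscSpace)
        (by ext1 ψ; exact displacementOp_apply_neg hħ.ne' r w ψ)
        (by ext1 ψ; exact displacementOp_neg_apply hħ.ne' r w ψ)
      norm_map' := norm_displacementOp hħ.ne' r w } (hermiteBasis hr).repr)

theorem inner_displacedBasis (hħ : 0 < ħ) (hr : 0 < r) (w : ℂ) (n : ℕ) (ψ : OscSpace) :
    inner ℂ (displacedBasis hħ hr w n) ψ =
      inner ℂ (hermiteBasis hr n) (displacementOp ħ r w ψ) := by
  rw [← HilbertBasis.repr_apply_apply, ← HilbertBasis.repr_apply_apply]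
  rfl

/-- Completing the square absorbs the linear terms into a further displacement, so the operator is
diagonal in the basis `D(w)† b_n` with eigenvalues `-ħgn + ħg|κ|² - ħp`. -/
theorem isSelfAdjoint_potentialOp (hħ : 0 < ħ) (hr : 0 < r) (hf : DifferentiableAt ℝ f x)
    (hγ : partialDeriv μ γ x ≠ 0) : IsSelfAdjoint (potentialOp ħ r f φ γ μ x) := by
  have hL := isLowering_annihilationOp hħ.ne' hr
  obtain ⟨z, hz⟩ : ∃ z, f x = z := ⟨_, rfl⟩
  obtain ⟨δ, hδ⟩ : ∃ δ, partialDeriv μ f x = δ := ⟨_, rfl⟩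
  obtain ⟨p, hp⟩ : ∃ p, partialDeriv μ φ x = p := ⟨_, rfl⟩
  obtain ⟨g, hg⟩ : ∃ g, partialDeriv μ γ x = g := ⟨_, rfl⟩
  rw [hg] at hγ
  -- Chosen so that `-ħgκ` is the coefficient of `(a+f)†`; that of `(a+f)` is then `-ħg κ̄`, and
  -- this match is why the operator is symmetric.
  set κ : ℂ := -(Complex.I * (Complex.exp (Complex.I * γ x) - 1) * δ / g) with hκ
  have hκ' : conj κ = Complex.I * (Complex.exp (-(Complex.I * γ x)) - 1) * conj δ / g := by
    rw [hκ]
    simp only [map_neg, map_div₀, map_mul, map_sub, map_one, Complex.conj_I, Complex.conj_ofReal,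
      ← Complex.exp_conj]
    ring_nf
  have hħ' : (ħ : ℂ) ≠ 0 := by exact_mod_cast hħ.ne'
  have hg' : (g : ℂ) ≠ 0 := by exact_mod_cast hγ
  set w := z + κ with hw
  have key : ∀ {ψ α β ν : OscSpace} (h : LadderImages ħ r ψ α β ν)
      (hd : ψ ∈ (potentialOp ħ r f φ γ μ x).domain),
      potentialOp ħ r f φ γ μ x ⟨ψ, hd⟩ =
        (-(ħ * g) : ℂ) • (ν + w • β + conj w • (α + w • ψ)) +
        ((ħ * g * Complex.normSq κ - ħ * p : ℝ) : ℂ) • ψ := by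
    intro ψ α β ν h hd
    rw [potentialOp_apply hħ hr h hf hd hz rfl hδ hp hg]
    have e1 : Complex.I * ħ * (Complex.exp (Complex.I * γ x) - 1) * δ = -(ħ * g * κ) := by
      rw [hκ]
      field_simp
    have e2 : Complex.I * ħ * (Complex.exp (-(Complex.I * γ x)) - 1) * conj δ =
        ħ * g * conj κ := by
      rw [hκ']
      field_simp
    have e3 : ((Complex.normSq κ : ℝ) : ℂ) = κ * conj κ := (Complex.mul_conj κ).symm
    rw [e1, e2, hw, map_add]
    push_cast
    rw [e3]
    module
  refine isSelfAdjoint_of_diagonal (displacedBasis hħ hr w)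
    (fun n => -(ħ * g) * n + (ħ * g * Complex.normSq κ - ħ * p)) fun ψ χ => ?_
  simp only [inner_displacedBasis]
  have hcoef : ∀ {ψ α β ν : OscSpace} (h : LadderImages ħ r ψ α β ν)
      (hd : ψ ∈ (potentialOp ħ r f φ γ μ x).domain) (n : ℕ),
      inner ℂ (hermiteBasis hr n) (displacementOp ħ r w (potentialOp ħ r f φ γ μ x ⟨ψ, hd⟩)) =
        ((-(ħ * g) * n + (ħ * g * Complex.normSq κ - ħ * p) : ℝ) : ℂ) *
          inner ℂ (hermiteBasis hr n) (displacementOp ħ r w ψ) := by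
    intro ψ α β ν h hd n
    have h1 := (hL.mem_number_graph.1 (h.displace hħ hr w).mem_number_graph) n
    rw [key h hd, map_add, map_smul, map_smul, inner_add_right, inner_smul_right,
      inner_smul_right, h1]
    push_cast
    ring
  constructor
  · intro h n
    obtain ⟨u, rfl, rfl⟩ := (LinearPMap.mem_graph_iff _).1 h
    have hu : (u : OscSpace) ∈ (numberOp ħ r).domain := by
      rw [← potentialOp_domain hħ hr]
      exact u.2
    obtain ⟨ν, hν⟩ := LinearPMap.mem_domain_iff.1 hu
    obtain ⟨α, β, hl⟩ := exists_ladderImages hħ hr hν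
    exact hcoef hl u.2 n
  · intro H
    set c : ℝ := ħ * g * Complex.normSq κ - ħ * p with hc
    -- Solving the eigenvalue relation for `n c_n`, possible as `g ≠ 0`, exhibits `N D(w)ψ`.
    -- Displacing back by `-w` shows that `ψ` lies in the domain.
    have h1 : (displacementOp ħ r w ψ, displacementOp ħ r w
        ((-(ħ * g) : ℂ)⁻¹ • (χ - (c : ℂ) • ψ))) ∈ (numberOp ħ r).graph := by
      refine hL.mem_number_graph.2 fun n => ?_
      rw [map_smul, map_sub, map_smul, inner_smul_right, inner_sub_right, inner_smul_right, H n]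
      push_cast
      field_simp
      ring
    obtain ⟨α, β, hl⟩ := exists_ladderImages hħ hr h1
    have hl' := hl.displace hħ hr (-w)
    rw [displacementOp_neg_apply hħ.ne'] at hl'
    have hd : ψ ∈ (potentialOp ħ r f φ γ μ x).domain := by
      rw [potentialOp_domain hħ hr]
      exact LinearPMap.mem_domain_of_mem_graph hl'.mem_number_graph
    refine (LinearPMap.mem_graph_iff _).2 ⟨⟨ψ, hd⟩, rfl, ?_⟩
    refine hilbertBasis_ext (displacedBasis hħ hr w) fun n => ?_
    rw [inner_displacedBasis, inner_displacedBasis, hcoef hl' hd n, H n]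

theorem differentiableAt_gaugeOp (hħ : 0 < ħ) (hr : 0 < r) {ζ : OscSpace}
    (hζ : ζ ∈ (numberOp ħ r).domain) (hf : DifferentiableAt ℝ f x)
    (hφ : DifferentiableAt ℝ φ x) (hγ : DifferentiableAt ℝ γ x) :
    DifferentiableAt ℝ (fun x => gaugeOp ħ r f φ γ x ζ) x := by
  obtain ⟨ν, hν⟩ := LinearPMap.mem_domain_iff.1 hζ
  obtain ⟨α, β, h⟩ := exists_ladderImages hħ hr hν
  have h1 := h.displace hħ hr (f x)
  obtain ⟨G, hG, -⟩ := exists_hasFDerivAt_gaugeOp hħ hr h hf.hasFDerivAt hφ.hasFDerivAt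
    hγ.hasFDerivAt rfl rfl rfl h1.mem_number_graph (h1.rotate hħ hr (γ x))
  exact hG.differentiableAt

/-- The ladder images of `η` come from displacing by `z`, rotating by `γ` and displacing by `-z`, so
both sides are combinations of the same four transported vectors. -/
theorem gaugeOp_equation (hħ : 0 < ħ) (hr : 0 < r) {ζ : OscSpace}
    (hζ : ζ ∈ (numberOp ħ r).domain) (hf : DifferentiableAt ℝ f x)
    (hφ : DifferentiableAt ℝ φ x) (hγ : DifferentiableAt ℝ γ x) :
    ∃ hη : gaugeOp ħ r f φ γ x ζ ∈ (potentialOp ħ r f φ γ μ x).domain,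
      (Complex.I * (ħ : ℂ)) • partialDeriv μ (fun y => gaugeOp ħ r f φ γ y ζ) x =
        potentialOp ħ r f φ γ μ x ⟨gaugeOp ħ r f φ γ x ζ, hη⟩ := by
  obtain ⟨ν, hν⟩ := LinearPMap.mem_domain_iff.1 hζ
  obtain ⟨α, β, h⟩ := exists_ladderImages hħ hr hν
  obtain ⟨z, hz⟩ : ∃ z, f x = z := ⟨_, rfl⟩
  obtain ⟨e, he⟩ : ∃ e, Complex.exp (Complex.I * φ x) = e := ⟨_, rfl⟩
  obtain ⟨V, hV⟩ : ∃ V, (numberGroup hr (γ x) : OscSpace →L[ℂ] OscSpace) = V := ⟨_, rfl⟩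
  obtain ⟨θ, hθ⟩ : ∃ θ, Complex.I * γ x = θ := ⟨_, rfl⟩
  have h1 := h.displace hħ hr z
  have h2 := h1.rotate hħ hr (γ x)
  rw [hV, hθ] at h2
  have h3 := (h2.displace hħ hr (-z)).smul e
  obtain ⟨G, hG, hG'⟩ := exists_hasFDerivAt_gaugeOp hħ hr h hf.hasFDerivAt hφ.hasFDerivAt
    hγ.hasFDerivAt hz he hV h1.mem_number_graph h2
  have hη : gaugeOp ħ r f φ γ x ζ = e • displacementOp ħ r (-z) (V (displacementOp ħ r z ζ)) := by
    rw [gaugeOp_apply hħ hr, hz, he, hV]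
  rw [partialDeriv, hG.fderiv, hG', hη]
  have hd : e • displacementOp ħ r (-z) (V (displacementOp ħ r z ζ)) ∈
      (potentialOp ħ r f φ γ μ x).domain := by
    rw [potentialOp_domain hħ hr]
    exact LinearPMap.mem_domain_of_mem_graph h3.mem_number_graph
  refine ⟨hd, ?_⟩
  obtain ⟨δ, hδ⟩ : ∃ δ, partialDeriv μ f x = δ := ⟨_, rfl⟩
  obtain ⟨p, hp⟩ : ∃ p, partialDeriv μ φ x = p := ⟨_, rfl⟩
  obtain ⟨g, hg⟩ : ∃ g, partialDeriv μ γ x = g := ⟨_, rfl⟩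
  rw [potentialOp_apply hħ hr h3 hf hd hz hθ hδ hp hg]
  rw [partialDeriv] at hδ hp hg
  rw [hδ, hp, hg]
  -- Both displacement derivatives contribute the same scalar `i Im(z̄δ)`; doubled, it cancels the
  -- cross terms in `z̄δ` and `zδ̄` in the coefficient of `ζ`.
  have him : ((conj z * δ).im : ℂ) * Complex.I * 2 = conj z * δ - z * conj δ := by
    have := Complex.sub_conj (conj z * δ)
    rw [map_mul, Complex.conj_conj] at this
    rw [this]
    push_cast
    ring
  have him' : (conj (-z) * -δ).im = (conj z * δ).im := by
    rw [map_neg, neg_mul_neg]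
  have hexp : Complex.exp θ * Complex.exp (-θ) = 1 := by
    rw [← Complex.exp_add, add_neg_cancel, Complex.exp_zero]
  have hI := Complex.I_sq
  rw [him']
  generalize hm : ((conj z * δ).im : ℂ) = m at *
  generalize Complex.exp θ = c at *
  generalize Complex.exp (-θ) = c' at *
  simp only [map_add, map_sub, map_smul, map_neg]
  generalize displacementOp ħ r (-z) (V (displacementOp ħ r z α)) = A
  generalize displacementOp ħ r (-z) (V (displacementOp ħ r z β)) = B
  generalize displacementOp ħ r (-z) (V (displacementOp ħ r z ζ)) = Z
  generalize displacementOp ħ r (-z) (V (displacementOp ħ r z ν)) = M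
  -- The four goals are the coefficients of the transported `a†ζ`, `ζ`, `aζ` and `a†aζ`, in this
  -- order.
  match_scalars
  · linear_combination (ħ * e * g * z) * hI - (Complex.I * ħ * e * δ) * hexp
  · linear_combination (ħ * e * p + ħ * e * g * z * conj z) * hI + (Complex.I * ħ * e) * him -
      (Complex.I * ħ * e * (conj z * δ - z * conj δ)) * hexp
  · linear_combination (ħ * e * g * conj z) * hI + (Complex.I * ħ * e * conj δ) * hexp
  · linear_combination (ħ * e * g) * hI

end

end OscillatorField

theorem mainTheorem3 (ħ r : ℝ) (hħ : 0 < ħ) (hr : 0 < r)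
    (f : Minkowski → ℂ) (φ γ : Minkowski → ℝ)
    (hf : ContDiff ℝ 1 f) (hφ : ContDiff ℝ 1 φ) (hγ : ContDiff ℝ 1 γ) :
    (∀ ζ ∈ (numberOp ħ r).domain,
      Differentiable ℝ (fun x => gaugeOp ħ r f φ γ x ζ)) ∧
    (∀ (μ : Fin 4) (x : Minkowski), partialDeriv μ γ x ≠ 0 →
      (potentialOp ħ r f φ γ μ x).domain = (numberOp ħ r).domain ∧
      IsSelfAdjoint (potentialOp ħ r f φ γ μ x) ∧
      ∀ ζ ∈ (numberOp ħ r).domain,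
        ∃ hη : gaugeOp ħ r f φ γ x ζ ∈ (potentialOp ħ r f φ γ μ x).domain,
          (Complex.I * (ħ : ℂ)) • partialDeriv μ (fun y => gaugeOp ħ r f φ γ y ζ) x =
            potentialOp ħ r f φ γ μ x ⟨gaugeOp ħ r f φ γ x ζ, hη⟩) := by
  refine ⟨fun ζ hζ x => differentiableAt_gaugeOp hħ hr hζ (hf.differentiable (by simp) x)
      (hφ.differentiable (by simp) x) (hγ.differentiable (by simp) x), fun μ x hμ =>
    ⟨potentialOp_domain hħ hr, isSelfAdjoint_potentialOp hħ hr (hf.differentiable (by simp) x) hμ,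
      fun ζ hζ => gaugeOp_equation hħ hr hζ (hf.differentiable (by simp) x)
        (hφ.differentiable (by simp) x) (hγ.differentiable (by simp) x)⟩⟩
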